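/- Let $H$ be a real separable Hilbert space, $T>0$, let $\phi:H\to(-\infty,\infty]$ be convex, proper and lower semicontinuous with conjugate $\phi^*(\xi)=\sup_{x\in H}\big((\xi,x)-\phi(x)\big)$, and let $y_0\in D(\phi)=\{\phi<\infty\}$. Let $\emptyset\neq U\subset L^2(0,T;H)$ be compact. Let $\tau$ be the strong $\times$ weak topology of $X=L^2(0,T;H)\times H^1(0,T;H)$, and let $F:X\to[0,\infty]$ be $\tau$-lower semicontinuous and $\tau$-coercive (for every $c<\infty$ the sublevel $\{F\le c\}$ is contained in a $\tau$-compact set), with $F(u,y)<\infty$ only if $u\in U$. Define the Brezis--Ekeland--Nayroles functional $$G(u,y)=\int_0^T\big(\phi(y)+\phi^*(u-y')-(u,y)\big)\,dt+\tfrac12\|y(T)\|^2-\tfrac12\|y_0\|^2\quad\text{if }y(0)=y_0,$$ and $G(u,y)=\infty$ otherwise (the integral is $+\infty$ if $\phi(y)$ or $\phi^*(u-y')$ is not in $L^1(0,T)$). For $\varepsilon>0$ put $E_\varepsilon=F+\varepsilon^{-1}G$, and let $E_0=F$ on $\{G=0\}$ and $E_0=\infty$ elsewhere. Then: 1. For every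 $\varepsilon>0$ the functional $E_\varepsilon$ has a minimizer on $X$. 2. $E_\varepsilon$ $\Gamma$-converges to $E_0$ with respect to $\tau$ as $\varepsilon\to0^+$: $E_0(x)\le\liminf_{\varepsilon\to0}E_\varepsilon(x_\varepsilon)$ whenever $x_\varepsilon\stackrel{\tau}{\to}x$, and for every $x\in X$ there are $x_\varepsilon\stackrel{\tau}{\to}x$ with $E_\varepsilon(x_\varepsilon)\to E_0(x)$. 3. Suppose that for at least one $u\in U$ one has $F(u,y)<\infty$ for the solution $y\in H^1(0,T;H)$ of $y'+\partial\phi(y)\ni u$ a.e. in $(0,T)$, $y(0)=y_0$. Then $E_\varepsilon\not\equiv\infty$ for every $\varepsilon>0$, and if $\varepsilon_n>0$, $\varepsilon_n\to0$ and $x_n\in X$ satisfy $\liminf_{n\to\infty}\big(E_{\varepsilon_n}(x_n)-\inf E_{\varepsilon_n}\big)=0$, then a subsequence of $(x_n)$ $\tau$-converges to a minimizer of $E_0$. 4. If $E_0$ has a unique minimizer $x_0$, and $\varepsilon_n>0$, $\varepsilon_n\to0$ and $x_n\in X$ satisfy $\lim_{n\to\infty}\big(E_{\varepsilon_n}(x_n)-\inf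 E_{\varepsilon_n}\big)=0$, then $x_n\stackrel{\tau}{\to}x_0$. -/

import Mathlib

open MeasureTheory Filter Topology Set
open scoped ENNReal ContDiff

noncomputable section

namespace BEN

/-- Lebesgue measure on the time interval `(0,T)`. -/
abbrev timeMeasure (T : ℝ) : Measure ℝ := volume.restrict (Ioo 0 T)

/-- The Bochner space `L²(0,T;H)`. -/
abbrev L2 (T : ℝ) (H : Type*) [NormedAddCommGroup H] := Lp H 2 (timeMeasure T)

/-- `ψ` is a test function on `(0,T)`, an element of `C_c^∞(0,T)`. -/
def IsTestFunction (T : ℝ) (ψ : ℝ → ℝ) : Prop :=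
  ContDiff ℝ ∞ ψ ∧ HasCompactSupport ψ ∧ tsupport ψ ⊆ Ioo 0 T

/-- `v` is the weak derivative of `y` on `(0,T)`. -/
def IsWeakDeriv {H : Type*} [NormedAddCommGroup H] [NormedSpace ℝ H] {T : ℝ}
    (y v : L2 T H) : Prop :=
  ∀ ψ : ℝ → ℝ, IsTestFunction T ψ →
    ∫ t, deriv ψ t • y t ∂(timeMeasure T) = -∫ t, ψ t • v t ∂(timeMeasure T)

theorem integrable_smul_of_compactSupport {H : Type*} [NormedAddCommGroup H] [NormedSpace ℝ H]
    {T : ℝ} {ψ : ℝ → ℝ} (hc : Continuous ψ) (hs : HasCompactSupport ψ) (y : L2 T H) :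
    Integrable (fun t => ψ t • y t) (timeMeasure T) := by
  obtain ⟨C, hC⟩ := hc.bounded_above_of_compact_support hs
  exact ((Lp.memLp y).integrable (by norm_num)).bdd_smul C hc.aestronglyMeasurable
    (Eventually.of_forall hC)

/-- The Bochner–Sobolev space `H¹(0,T;H)`, realized as the space of pairs `(y, y')` in
`L²(0,T;H) × L²(0,T;H)` with `y'` the weak derivative of `y`. It inherits the Hilbert norm
`‖y‖² = ‖y‖²_{L²} + ‖y'‖²_{L²}`. -/
def H1 (T : ℝ) (H : Type*) [NormedAddCommGroup H] [InnerProductSpace ℝ H] :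
    Submodule ℝ (WithLp 2 (L2 T H × L2 T H)) where
  carrier := {p | IsWeakDeriv p.fst p.snd}
  zero_mem' := by
    intro ψ _
    have h : ∀ᵐ t ∂(timeMeasure T), (0 : L2 T H) t = 0 := Lp.coeFn_zero _ _ _
    have h1 : ∫ t, deriv ψ t • (0 : L2 T H) t ∂(timeMeasure T) = 0 :=
      integral_eq_zero_of_ae (by filter_upwards [h] with t ht; rw [ht, smul_zero]; rfl)
    have h2 : ∫ t, ψ t • (0 : L2 T H) t ∂(timeMeasure T) = 0 :=
      integral_eq_zero_of_ae (by filter_upwards [h] with t ht; rw [ht, smul_zero]; rfl)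
    simp only [WithLp.zero_fst, WithLp.zero_snd, h1, h2, neg_zero]
  add_mem' := by
    intro p q hp hq ψ hψ
    have key : ∀ (χ : ℝ → ℝ), Continuous χ → HasCompactSupport χ → ∀ a b : L2 T H,
        ∫ t, χ t • (a + b) t ∂(timeMeasure T) =
          ∫ t, χ t • a t ∂(timeMeasure T) + ∫ t, χ t • b t ∂(timeMeasure T) := by
      intro χ hχ hs a b
      rw [← integral_add (integrable_smul_of_compactSupport hχ hs a)
        (integrable_smul_of_compactSupport hχ hs b)]
      refine integral_congr_ae ?_
      filter_upwards [Lp.coeFn_add a b] with t ht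
      rw [ht, Pi.add_apply, smul_add]
    have hd : Continuous (deriv ψ) := hψ.1.continuous_deriv (by simp)
    simp only [WithLp.add_fst, WithLp.add_snd]
    rw [key _ hd hψ.2.1.deriv, key _ hψ.1.continuous hψ.2.1, hp ψ hψ, hq ψ hψ]
    abel
  smul_mem' := by
    intro c p hp ψ hψ
    have key : ∀ (χ : ℝ → ℝ) (a : L2 T H),
        ∫ t, χ t • (c • a) t ∂(timeMeasure T) = c • ∫ t, χ t • a t ∂(timeMeasure T) := by
      intro χ a
      rw [← integral_smul]
      refine integral_congr_ae ?_
      filter_upwards [Lp.coeFn_smul c a] with t ht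
      rw [ht, Pi.smul_apply, smul_comm]
    simp only [WithLp.smul_fst, WithLp.smul_snd]
    rw [key, key, hp ψ hψ, smul_neg]

section Trajectories

variable {T : ℝ} {H : Type*} [NormedAddCommGroup H] [InnerProductSpace ℝ H]

/-- The time derivative `y' ∈ L²(0,T;H)` of `y ∈ H¹(0,T;H)`. -/
def timeDeriv (y : H1 T H) : L2 T H := y.1.snd

open Classical in
/-- The continuous representative on `[0,T]` of `y ∈ H¹(0,T;H)`, which gives a meaning to
`y(t)` for every `t ∈ [0,T]`. It exists, and for `0 < T` it is unique on `[0,T]`, by the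
embedding of `H¹(0,T;H)` in `C([0,T];H)`; its values off `[0,T]` play no role. -/
def rep (y : H1 T H) : ℝ → H :=
  if h : ∃ f : ℝ → H, ContinuousOn f (Icc 0 T) ∧ y.1.fst =ᵐ[timeMeasure T] f then h.choose
  else 0

/-- The space `L²(0,T;H) × H¹(0,T;H)` of pairs (control, state), endowed with the
strong × weak topology `τ`. -/
abbrev ControlState (T : ℝ) (H : Type*) [NormedAddCommGroup H] [InnerProductSpace ℝ H] :=
  L2 T H × WeakSpace ℝ (H1 T H)

/-- The control component of a pair. -/
def ControlState.control (p : ControlState T H) : L2 T H := p.1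

/-- The state component of a pair, as an element of `H¹(0,T;H)`. -/
def ControlState.state (p : ControlState T H) : H1 T H := (toWeakSpace ℝ (H1 T H)).symm p.2

end Trajectories

section Convex

variable {H : Type*} [NormedAddCommGroup H] [InnerProductSpace ℝ H]

/-- `φ : H → (-∞,∞]` is convex, proper and lower semicontinuous. -/
structure IsConvexProperLsc (φ : H → EReal) : Prop where
  ne_bot : ∀ x, φ x ≠ ⊥
  proper : ∃ x, φ x ≠ ⊤
  convex : ∀ x y : H, ∀ a b : ℝ, 0 ≤ a → 0 ≤ b → a + b = 1 →
    φ (a • x + b • y) ≤ (a : EReal) * φ x + (b : EReal) * φ y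
  lsc : LowerSemicontinuous φ

/-- The convex conjugate `φ*(ξ) = sup_x ((ξ,x) - φ(x))`. -/
def conjugate (φ : H → EReal) (ξ : H) : EReal :=
  ⨆ x : H, (((inner ℝ ξ x : ℝ) : EReal) - φ x)

/-- The subdifferential of convex analysis. -/
def subdifferential (φ : H → EReal) (x : H) : Set H :=
  {ξ | φ x < ⊤ ∧ ∀ z : H, ((inner ℝ ξ (z - x) : ℝ) : EReal) ≤ φ z - φ x}

/-- `y ∈ H¹(0,T;H)` solves `y' + ∂φ(y) ∋ u` a.e. in `(0,T)`, `y(0) = y₀`. -/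
def IsGradientFlow {T : ℝ} (φ : H → EReal) (y₀ : H) (u : L2 T H) (y : H1 T H) : Prop :=
  rep y 0 = y₀ ∧
    ∀ᵐ t ∂(timeMeasure T), u t - timeDeriv y t ∈ subdifferential φ (rep y t)

/-- The extended-real function `f` belongs to `L¹(0,T)`. -/
def MemL1 (T : ℝ) (f : ℝ → EReal) : Prop :=
  (∀ᵐ t ∂(timeMeasure T), f t ≠ ⊤ ∧ f t ≠ ⊥) ∧
    Integrable (fun t => (f t).toReal) (timeMeasure T)

open Classical in
/-- The Brezis–Ekeland–Nayroles functional. It is `+∞` unless `y(0) = y₀` and both `φ(y)`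
and `φ*(u - y')` belong to `L¹(0,T)`. (As both functions are bounded from below by functions
in `L¹(0,T)`, the integral is `+∞` if one of the two does not belong to `L¹(0,T)`.) -/
def benFunctional {T : ℝ} (φ : H → EReal) (y₀ : H) (p : ControlState T H) : EReal :=
  let u := p.control
  let y := p.state
  if rep y 0 = y₀ ∧ MemL1 T (fun t => φ (rep y t)) ∧
      MemL1 T (fun t => conjugate φ (u t - timeDeriv y t)) then
    (((∫ t, ((φ (rep y t)).toReal + (conjugate φ (u t - timeDeriv y t)).toReal
        - inner ℝ (u t) (rep y t)) ∂(timeMeasure T))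
      + 1 / 2 * ‖rep y T‖ ^ 2 - 1 / 2 * ‖y₀‖ ^ 2 : ℝ) : EReal)
  else ⊤

/-- The penalized functional `E_ε = F + ε⁻¹ G`. -/
def penalized {X : Type*} (F : X → ℝ≥0∞) (G : X → EReal) (ε : ℝ) (x : X) : EReal :=
  (F x : EReal) + ((ε⁻¹ : ℝ) : EReal) * G x

open Classical in
/-- The limit functional: `E_0 = F` on `{G = 0}` and `E_0 = +∞` elsewhere. -/
def constrained {X : Type*} (F : X → ℝ≥0∞) (G : X → EReal) (x : X) : EReal :=
  if G x = 0 then (F x : EReal) else ⊤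

end Convex

section Variational

variable {X : Type*}

/-- `x` is a solution of `min E`. -/
def IsMinimizer (E : X → EReal) (x : X) : Prop := ∀ z, E x ≤ E z

/-- `F` is coercive: each of its sublevels is contained in a compact set. -/
def IsCoercive [TopologicalSpace X] (F : X → ℝ≥0∞) : Prop :=
  ∀ c : ℝ≥0∞, c < ⊤ → ∃ K : Set X, IsCompact K ∧ {x | F x ≤ c} ⊆ K

/-- `E ε` Γ-converges to `E₀` as `ε → 0⁺`. -/
def GammaConverges [TopologicalSpace X] (E : ℝ → X → EReal) (E₀ : X → EReal) : Prop :=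
  (∀ (x : X) (xs : ℝ → X), Tendsto xs (𝓝[>] 0) (𝓝 x) →
    E₀ x ≤ liminf (fun ε => E ε (xs ε)) (𝓝[>] 0)) ∧
  ∀ x : X, ∃ xs : ℝ → X, Tendsto xs (𝓝[>] 0) (𝓝 x) ∧
    Tendsto (fun ε => E ε (xs ε)) (𝓝[>] 0) (𝓝 (E₀ x))

end Variational

end BEN

end

/-! The Fenchel inequality `φ(y) + φ*(u - y') ≥ (u - y', y)` is an equality exactly when `u - y' ∈
∂φ(y)`. By the chain rule `∫ (y', y) = ½‖y(T)‖² - ½‖y(0)‖²`, the functional `G` is the integral of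
the gap in this inequality (`benFunctional_eq_integral_fenchelGap`). So `G ≥ 0`, its zeros are
gradient flows, and `ε⁻¹ G` is a penalization of the flow constraint.

The analytic core is the lower semicontinuity of `G` on `τ`-compact sets
(`lowerSemicontinuousOn_benFunctional`). After subtraction of affine minorants, the integrals of
`φ(y)` and `φ*(u - y')` are nonnegative and convex, strongly lower semicontinuous by Fatou and hence
weakly so. The term `½‖y(T)‖²` is weakly lower semicontinuous, and what remains, mainly `-∫ (u, y)`,
is strong × weak continuous as long as the states stay bounded. Compact sets suffice, because the
sublevels of `F` lie in them.

Given this, existence is the direct method. For the Γ-liminf inequality, a bound `E_ε ≤ d` forces `F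
≤ d` and `G ≤ ε d`; constant families are recovery families. Quasiminimizers converge because `inf
E_ε ≤ E_0` and the sublevels of `F` are compactly contained.

Properness in the third claim needs a zero of `G` for every control
(`exists_benFunctional_eq_zero`). It is the weak limit of flows driven by the Yosida approximation
of `∂φ`: these satisfy a Fenchel equality at the resolvent, the energy identity for the Moreau
envelope bounds them in `H¹`, and lower semicontinuity gives `G ≤ 0` in the limit. -/

noncomputable section

namespace BEN

/-! ### Abstract penalization: minimizers, Γ-limit and quasiminimizers of `F + ε⁻¹ g`. -/

section Penalization

variable {X : Type*}

theorem penalized_coe_eq (F g : X → ℝ≥0∞) {ε : ℝ} (hε : 0 < ε) (x : X) :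
    penalized F (fun y => (g y : EReal)) ε x
      = ((F x + ENNReal.ofReal ε⁻¹ * g x : ℝ≥0∞) : EReal) := by
  rw [penalized, EReal.coe_ennreal_add, EReal.coe_ennreal_mul,
    EReal.coe_ennreal_ofReal, max_eq_left (inv_nonneg.2 hε.le)]

theorem penalized_nonneg (F g : X → ℝ≥0∞) {ε : ℝ} (hε : 0 < ε) (x : X) :
    0 ≤ penalized F (fun y => (g y : EReal)) ε x := by
  rw [penalized_coe_eq F g hε]; exact EReal.coe_ennreal_nonneg _

theorem penalized_le_constrained (F g : X → ℝ≥0∞) {ε : ℝ} (hε : 0 < ε) (x : X) :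
    penalized F (fun y => (g y : EReal)) ε x ≤ constrained F (fun y => (g y : EReal)) x := by
  rw [penalized_coe_eq F g hε, constrained]
  split_ifs with h
  · have : g x = 0 := by simpa using h
    simp [this]
  · exact le_top

theorem iInf_penalized_nonneg (F g : X → ℝ≥0∞) {ε : ℝ} (hε : 0 < ε) :
    0 ≤ ⨅ q, penalized F (fun y => (g y : EReal)) ε q :=
  le_iInf fun q => penalized_nonneg F g hε q

theorem iInf_penalized_le_constrained (F g : X → ℝ≥0∞) {ε : ℝ} (hε : 0 < ε) (x : X) :
    ⨅ q, penalized F (fun y => (g y : EReal)) ε q ≤ constrained F (fun y => (g y : EReal)) x :=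
  (iInf_le _ x).trans (penalized_le_constrained F g hε x)

theorem le_of_penalized_le {F g : X → ℝ≥0∞} {ε : ℝ} (hε : 0 < ε) {x : X} {c : ℝ≥0∞}
    (h : penalized F (fun y => (g y : EReal)) ε x ≤ c) : F x ≤ c := by
  rw [penalized_coe_eq F g hε, EReal.coe_ennreal_le_coe_ennreal_iff] at h
  exact le_self_add.trans h

/-- `a - b ≤ δ` bounds `a` when `b` is finite. -/
theorem _root_.EReal.le_add_of_sub_lt {a b d : EReal} (hb : b ≠ ⊥) (hb' : b ≠ ⊤)
    (h : a - b < d) : a ≤ b + d := by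
  have := EReal.sub_le_iff_le_add (a := a) (b := b) (c := d) (Or.inl hb) (Or.inl hb')
  rw [add_comm]
  exact this.1 h.le

/-- Pointwise convergence is what makes the constant family a recovery family. -/
theorem tendsto_penalized_constrained (F g : X → ℝ≥0∞) (x : X) :
    Tendsto (fun ε => penalized F (fun y => (g y : EReal)) ε x) (𝓝[>] 0)
      (𝓝 (constrained F (fun y => (g y : EReal)) x)) := by
  have hpos : ∀ᶠ ε : ℝ in 𝓝[>] 0, 0 < ε := eventually_mem_nhdsWithin
  by_cases h : g x = 0
  · refine tendsto_const_nhds.congr' ?_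
    filter_upwards [hpos] with ε hε
    rw [penalized_coe_eq F g hε, constrained]
    simp [h]
  · have h1 : Tendsto (fun ε : ℝ => F x + ENNReal.ofReal ε⁻¹ * g x) (𝓝[>] 0) (𝓝 ⊤) := by
      have h2 : Tendsto (fun ε : ℝ => ENNReal.ofReal ε⁻¹ * g x) (𝓝[>] 0) (𝓝 (⊤ * g x)) :=
        ENNReal.Tendsto.mul_const
          (ENNReal.tendsto_ofReal_atTop.comp tendsto_inv_nhdsGT_zero) (Or.inl ENNReal.top_ne_zero)
      rw [ENNReal.top_mul h] at h2
      exact tendsto_nhds_top_mono' h2 fun ε => le_add_self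
    have h3 := (continuous_coe_ennreal_ereal.tendsto ⊤).comp h1
    have h4 : constrained F (fun y => (g y : EReal)) x = ((⊤ : ℝ≥0∞) : EReal) := by
      simp [constrained, h]
    rw [h4]
    refine h3.congr' ?_
    filter_upwards [hpos] with ε hε
    rw [penalized_coe_eq F g hε]
    rfl

variable [TopologicalSpace X]

/-- Direct method inside a compact set containing a sublevel of `F`; outside it `F` alone exceeds
the value at `x₁`. Semicontinuity of `g` is asked on compact sets only, which is all that the
Brezis–Ekeland–Nayroles functional is shown to have. -/
theorem exists_isMinimizer_penalized [T2Space X] [Nonempty X] {F g : X → ℝ≥0∞}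
    (hF : LowerSemicontinuous F) (hc : IsCoercive F)
    (hg : ∀ K, IsCompact K → LowerSemicontinuousOn g K) {ε : ℝ} (hε : 0 < ε) :
    ∃ x, IsMinimizer (penalized F (fun y => (g y : EReal)) ε) x := by
  by_cases htop : ∀ x, F x + ENNReal.ofReal ε⁻¹ * g x = ⊤
  · obtain ⟨x⟩ := ‹Nonempty X›
    refine ⟨x, fun z => ?_⟩
    rw [penalized_coe_eq F g hε, penalized_coe_eq F g hε, htop, htop]
  push Not at htop
  obtain ⟨x₁, hx₁⟩ := htop
  obtain ⟨K, hK, hsub⟩ := hc _ (lt_top_iff_ne_top.2 hx₁)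
  have hx₁K : x₁ ∈ K := hsub (show F x₁ ≤ _ from le_self_add)
  have hl : LowerSemicontinuousOn (fun x => F x + ENNReal.ofReal ε⁻¹ * g x) K := by
    refine (hF.lowerSemicontinuousOn K).add ?_
    have hcont : Continuous fun t : ℝ≥0∞ => ENNReal.ofReal ε⁻¹ * t :=
      ENNReal.continuous_const_mul ENNReal.ofReal_ne_top
    exact hcont.comp_lowerSemicontinuousOn (hg K hK) fun a b h => by dsimp only; gcongr
  obtain ⟨x, hxK, hx⟩ := hl.exists_isMinOn ⟨x₁, hx₁K⟩ hK
  refine ⟨x, fun z => ?_⟩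
  rw [penalized_coe_eq F g hε, penalized_coe_eq F g hε, EReal.coe_ennreal_le_coe_ennreal_iff]
  by_cases hz : F z ≤ F x₁ + ENNReal.ofReal ε⁻¹ * g x₁
  · exact hx (hsub hz)
  · exact (hx hx₁K).trans ((not_le.1 hz).le.trans le_self_add)

/-- Where the energies stay below `d`, the points lie in one compact set and `g ≤ ε d → 0`. The
filter is arbitrary because the bound is used along `𝓝[>] 0`, along subsequences and along
ultrafilters. -/
theorem constrained_le_liminf_penalized [T2Space X] {F g : X → ℝ≥0∞}
    (hF : LowerSemicontinuous F) (hc : IsCoercive F)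
    (hg : ∀ K, IsCompact K → LowerSemicontinuousOn g K) {ι : Type*} {l : Filter ι}
    {ε : ι → ℝ} (hε : ∀ᶠ i in l, 0 < ε i) (hε0 : Tendsto ε l (𝓝 0)) {x : X} {xs : ι → X}
    (hx : Tendsto xs l (𝓝 x)) :
    constrained F (fun y => (g y : EReal)) x
      ≤ liminf (fun i => penalized F (fun y => (g y : EReal)) (ε i) (xs i)) l := by
  by_contra hlt
  obtain ⟨c, hc1, hc2⟩ := exists_between (not_le.1 hlt)
  have h0 : (0 : EReal) ≤ liminf (fun i => penalized F (fun y => (g y : EReal)) (ε i) (xs i)) l :=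
    le_liminf_of_le (h := hε.mono fun i hi => penalized_nonneg F g hi _)
  have hcpos : 0 ≤ c := h0.trans hc1.le
  have hfr := frequently_lt_of_liminf_lt (h := hc1)
  obtain ⟨d, rfl⟩ : ∃ d : ℝ≥0∞, c = d := ⟨c.toENNReal, (EReal.coe_toENNReal hcpos).symm⟩
  have hd : d < ⊤ := by
    rw [← EReal.coe_ennreal_lt_coe_ennreal_iff]
    exact hc2.trans_le le_top
  -- Restricting the filter plays the role of passing to a subsequence with energies below `d`.
  set L := l ⊓ 𝓟 {i | penalized F (fun y => (g y : EReal)) (ε i) (xs i) < d} with hL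
  have : NeBot L := frequently_iff_neBot.1 hfr
  have hLl : L ≤ l := inf_le_left
  have hlt' : ∀ᶠ i in L, F (xs i) + ENNReal.ofReal (ε i)⁻¹ * g (xs i) < d := by
    have : ∀ᶠ i in L, penalized F (fun y => (g y : EReal)) (ε i) (xs i) < d :=
      mem_inf_of_right (mem_principal_self _)
    filter_upwards [this, hLl hε] with i hi hi'
    rwa [penalized_coe_eq F g hi', EReal.coe_ennreal_lt_coe_ennreal_iff] at hi
  have hFx : F x ≤ d := by
    by_contra h
    have h1 := (hx.mono_left hLl).eventually (hF x d (not_le.1 h))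
    obtain ⟨i, hi1, hi2⟩ := (h1.and hlt').exists
    exact absurd (hi1.trans_le le_self_add) hi2.le.not_gt
  obtain ⟨K, hK, hsub⟩ := hc d hd
  have hxK : ∀ᶠ i in L, xs i ∈ K :=
    hlt'.mono fun i hi => hsub (show F (xs i) ≤ d from le_self_add.trans hi.le)
  have hxm : x ∈ K := hK.isClosed.mem_of_tendsto (hx.mono_left hLl) hxK
  have hgx : g x = 0 := by
    by_contra h
    obtain ⟨a, ha0, ha⟩ := exists_between (pos_iff_ne_zero.2 h)
    have h1 : ∀ᶠ i in L, a < g (xs i) :=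
      (tendsto_nhdsWithin_iff.2 ⟨hx.mono_left hLl, hxK⟩).eventually (hg K hK x hxm a ha)
    have h2 : ∀ᶠ i in L, a ≤ ENNReal.ofReal (ε i) * d := by
      filter_upwards [h1, hlt', hLl hε] with i hi1 hi2 hi3
      have h3 : ENNReal.ofReal (ε i)⁻¹ * a ≤ d := by
        calc ENNReal.ofReal (ε i)⁻¹ * a ≤ ENNReal.ofReal (ε i)⁻¹ * g (xs i) := by gcongr
          _ ≤ _ := le_add_self
          _ ≤ d := hi2.le
      calc a = ENNReal.ofReal (ε i) * (ENNReal.ofReal (ε i)⁻¹ * a) := by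
              rw [← mul_assoc, ← ENNReal.ofReal_mul hi3.le, mul_inv_cancel₀ hi3.ne']; simp
        _ ≤ _ := by gcongr
    have h3 : Tendsto (fun i => ENNReal.ofReal (ε i) * d) L (𝓝 (ENNReal.ofReal 0 * d)) :=
      ENNReal.Tendsto.mul_const (ENNReal.tendsto_ofReal (hε0.mono_left hLl)) (Or.inr hd.ne)
    have h4 := ge_of_tendsto h3 h2
    simp only [ENNReal.ofReal_zero, zero_mul, nonpos_iff_eq_zero] at h4
    exact ha0.ne' h4
  have : constrained F (fun y => (g y : EReal)) x ≤ d := by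
    simp only [constrained, hgx, EReal.coe_ennreal_zero, if_true]
    exact EReal.coe_ennreal_le_coe_ennreal_iff.2 hFx
  exact absurd hc2 this.not_gt

theorem gammaConverges_penalized [T2Space X] {F g : X → ℝ≥0∞}
    (hF : LowerSemicontinuous F) (hc : IsCoercive F)
    (hg : ∀ K, IsCompact K → LowerSemicontinuousOn g K) :
    GammaConverges (penalized F (fun y => (g y : EReal)))
      (constrained F (fun y => (g y : EReal))) :=
  ⟨fun _ _ hx => constrained_le_liminf_penalized hF hc hg (ε := id) eventually_mem_nhdsWithin
    (tendsto_id.mono_left nhdsWithin_le_nhds) hx,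
    fun x => ⟨fun _ => x, tendsto_const_nhds, tendsto_penalized_constrained F g x⟩⟩

/-- Along the filter, `E_ε(xs) ≤ inf E_ε + d ≤ E_0(q) + d`; the liminf inequality then gives `E_0(x)
≤ E_0(q) + d` for every `d > 0`. -/
theorem isMinimizer_of_tendsto [T2Space X] {F g : X → ℝ≥0∞}
    (hF : LowerSemicontinuous F) (hc : IsCoercive F)
    (hg : ∀ K, IsCompact K → LowerSemicontinuousOn g K) {ι : Type*} {l : Filter ι} [NeBot l]
    {ε : ι → ℝ} (hε : ∀ i, 0 < ε i) (hε0 : Tendsto ε l (𝓝 0)) {x : X} {xs : ι → X}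
    (hx : Tendsto xs l (𝓝 x))
    (hq : ∀ d : ℝ, 0 < d → ∀ᶠ i in l, penalized F (fun y => (g y : EReal)) (ε i) (xs i)
      - ⨅ q, penalized F (fun y => (g y : EReal)) (ε i) q < d) :
    IsMinimizer (constrained F (fun y => (g y : EReal))) x := by
  intro q
  by_cases hqt : constrained F (fun y => (g y : EReal)) q = ⊤
  · rw [hqt]; exact le_top
  have hq0 : (0 : EReal) ≤ constrained F (fun y => (g y : EReal)) q := by
    rw [constrained]; split_ifs
    · exact EReal.coe_ennreal_nonneg _
    · exact le_top
  refine EReal.le_of_forall_lt_iff_le.1 fun z hz => ?_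
  have hzpos : 0 < (z : EReal) - constrained F (fun y => (g y : EReal)) q := EReal.sub_pos.2 hz
  obtain ⟨r, hr⟩ : ∃ r : ℝ, constrained F (fun y => (g y : EReal)) q = r :=
    ⟨_, (EReal.coe_toReal hqt (fun h => by rw [h] at hq0; simp at hq0)).symm⟩
  have hd : 0 < z - r := by
    rw [hr] at hz; exact sub_pos.2 (by exact_mod_cast hz)
  refine (constrained_le_liminf_penalized hF hc hg (Eventually.of_forall hε) hε0 hx).trans ?_
  refine liminf_le_of_frequently_le' ((hq _ hd).mono fun i hi => ?_).frequently
  have hle := iInf_penalized_le_constrained F g (hε i) q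
  have hge := iInf_penalized_nonneg F g (hε i)
  refine (EReal.le_add_of_sub_lt (fun h => by rw [h] at hge; simp at hge)
    (fun h => by rw [h, top_le_iff] at hle; exact hqt hle) hi).trans ?_
  rw [hr] at hle
  calc _ ≤ (r : EReal) + ((z - r : ℝ) : EReal) := by gcongr
    _ = z := by rw [← EReal.coe_add]; congr 1; ring

/-- Since `inf E_ε ≤ E_0(q) = F(q)`, a gap below `1` gives `F(x) ≤ F(q) + 1`, a bound independent of
`ε`. -/
theorem exists_compact_of_quasiminimizing {F g : X → ℝ≥0∞} (hc : IsCoercive F) {q : X}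
    (hq : constrained F (fun y => (g y : EReal)) q < ⊤) :
    ∃ K : Set X, IsCompact K ∧ ∀ (ε : ℝ) (x : X), 0 < ε →
      penalized F (fun y => (g y : EReal)) ε x
        - ⨅ z, penalized F (fun y => (g y : EReal)) ε z < 1 → x ∈ K := by
  have hgq : g q = 0 := by
    by_contra h
    simp [constrained, h] at hq
  have hFq : F q < ⊤ := by
    simp only [constrained, hgq, EReal.coe_ennreal_zero, if_true] at hq
    rwa [← EReal.coe_ennreal_top, EReal.coe_ennreal_lt_coe_ennreal_iff] at hq
  obtain ⟨K, hK, hsub⟩ := hc (F q + 1) (by simp [hFq])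
  refine ⟨K, hK, fun ε x hε hx => hsub ?_⟩
  have hle := iInf_penalized_le_constrained F g hε q
  have hge := iInf_penalized_nonneg F g hε
  have h1 := EReal.le_add_of_sub_lt (fun h => by rw [h] at hge; simp at hge)
    (hle.trans_lt hq).ne hx
  refine le_of_penalized_le hε (h1.trans ?_)
  simp only [constrained, hgq, EReal.coe_ennreal_zero, if_true] at hle
  rw [EReal.coe_ennreal_add, EReal.coe_ennreal_one]
  gcongr

theorem exists_subseq_tendsto_minimizer [T2Space X] {F g : X → ℝ≥0∞}
    (hF : LowerSemicontinuous F) (hc : IsCoercive F)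
    (hg : ∀ K, IsCompact K → LowerSemicontinuousOn g K)
    (hseq : ∀ K : Set X, IsCompact K → IsSeqCompact K) {q : X}
    (hq : constrained F (fun y => (g y : EReal)) q < ⊤)
    {ε : ℕ → ℝ} (hε : ∀ n, 0 < ε n) (hε0 : Tendsto ε atTop (𝓝 0)) {x : ℕ → X}
    (hlim : liminf (fun n => penalized F (fun y => (g y : EReal)) (ε n) (x n)
      - ⨅ z, penalized F (fun y => (g y : EReal)) (ε n) z) atTop = 0) :
    ∃ (k : ℕ → ℕ) (x₀ : X), StrictMono k ∧ Tendsto (fun n => x (k n)) atTop (𝓝 x₀) ∧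
      IsMinimizer (constrained F (fun y => (g y : EReal))) x₀ := by
  obtain ⟨K, hK, hKx⟩ := exists_compact_of_quasiminimizing hc hq
  -- Only the liminf of the gaps vanishes, so a first extraction selects indices with gap below `1 /
  -- (n + 1)`; compactness provides a second one.
  have hfr : ∀ n : ℕ, ∃ᶠ i in atTop, penalized F (fun y => (g y : EReal)) (ε i) (x i)
      - ⨅ z, penalized F (fun y => (g y : EReal)) (ε i) z < ((1 / ((n : ℝ) + 1) : ℝ) : EReal) := by
    intro n
    refine frequently_lt_of_liminf_lt (h := ?_)
    rw [hlim]
    exact_mod_cast Nat.one_div_pos_of_nat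
  obtain ⟨k, hk, hkx⟩ := extraction_forall_of_frequently hfr
  obtain ⟨x₀, -, m, hm, hx₀⟩ := hseq K hK (x := fun n => x (k n)) fun n => by
    refine hKx (ε (k n)) _ (hε _) ((hkx n).trans_le ?_)
    have : 1 / ((n : ℝ) + 1) ≤ 1 := by
      rw [div_le_one (by positivity)]; linarith [(Nat.cast_nonneg n : (0 : ℝ) ≤ n)]
    exact_mod_cast this
  refine ⟨k ∘ m, x₀, hk.comp hm, hx₀, ?_⟩
  refine isMinimizer_of_tendsto hF hc hg (ε := fun n => ε (k (m n))) (fun n => hε _)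
    (hε0.comp (hk.comp hm).tendsto_atTop) hx₀ fun d hd => ?_
  filter_upwards [(tendsto_one_div_add_atTop_nhds_zero_nat (𝕜 := ℝ)).comp hm.tendsto_atTop
    |>.eventually_lt_const hd] with n hn
  exact (hkx (m n)).trans (by exact_mod_cast hn)

theorem tendsto_of_unique_minimizer [T2Space X] {F g : X → ℝ≥0∞}
    (hF : LowerSemicontinuous F) (hc : IsCoercive F)
    (hg : ∀ K, IsCompact K → LowerSemicontinuousOn g K) {x₀ : X}
    (hx₀ : ∀ q, IsMinimizer (constrained F (fun y => (g y : EReal))) q ↔ q = x₀)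
    {ε : ℕ → ℝ} (hε : ∀ n, 0 < ε n) (hε0 : Tendsto ε atTop (𝓝 0)) {x : ℕ → X}
    (hlim : Tendsto (fun n => penalized F (fun y => (g y : EReal)) (ε n) (x n)
      - ⨅ z, penalized F (fun y => (g y : EReal)) (ε n) z) atTop (𝓝 0)) :
    Tendsto x atTop (𝓝 x₀) := by
  -- If the minimal value is `⊤`, every point is a minimizer, so uniqueness reduces the space to one
  -- point.
  by_cases ht : constrained F (fun y => (g y : EReal)) x₀ = ⊤
  · have : ∀ q, q = x₀ := fun q => (hx₀ q).1 fun z => by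
      have h1 := (hx₀ x₀).2 rfl z
      rw [ht, top_le_iff] at h1
      rw [h1]; exact le_top
    exact tendsto_const_nhds.congr fun n => (this (x n)).symm
  obtain ⟨K, hK, hKx⟩ := exists_compact_of_quasiminimizing hc (lt_top_iff_ne_top.2 ht)
  have hev : ∀ d : ℝ, 0 < d → ∀ᶠ n in atTop, penalized F (fun y => (g y : EReal)) (ε n) (x n)
      - ⨅ z, penalized F (fun y => (g y : EReal)) (ε n) z < d := fun d hd =>
    hlim.eventually_lt_const (by exact_mod_cast hd)
  -- Each cluster point is a limit along an ultrafilter and hence a minimizer, so it equals `x₀`;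
  -- this form of the argument needs no sequential compactness.
  refine hK.le_nhds_of_unique_clusterPt ?_ fun y _ hy => ?_
  · exact (hev 1 one_pos).mono fun n hn => hKx (ε n) _ (hε n) (by exact_mod_cast hn)
  · obtain ⟨u, hu, hux⟩ := mapClusterPt_iff_ultrafilter.1 hy
    exact (hx₀ y).1 (isMinimizer_of_tendsto hF hc hg hε (hε0.mono_left hu) hux
      fun d hd => hu (hev d hd))

end Penalization

/-! ### Time integrals and primitives in `L²(0,T;H)`. -/

section TimeIntegrals

variable {T : ℝ} {H : Type*} [NormedAddCommGroup H]

instance : IsFiniteMeasure (timeMeasure T) := ⟨by simp [timeMeasure]⟩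

theorem integrable_coe (y : L2 T H) : Integrable (fun t => y t) (timeMeasure T) :=
  (Lp.memLp y).integrable (by norm_num)

/-- Hölder's inequality on an interval of finite length; `max T 0` spares a sign condition on `T`.
-/
theorem integral_norm_le (y : L2 T H) :
    ∫ t, ‖y t‖ ∂(timeMeasure T) ≤ √(max T 0) * ‖y‖ := by
  have h := eLpNorm_le_eLpNorm_mul_rpow_measure_univ (p := 1) (q := 2) (μ := timeMeasure T)
    (by norm_num) (Lp.aestronglyMeasurable y)
  have h1 : ∫ t, ‖y t‖ ∂(timeMeasure T) = (eLpNorm y 1 (timeMeasure T)).toReal := by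
    rw [integral_norm_eq_lintegral_enorm (Lp.aestronglyMeasurable y), eLpNorm_one_eq_lintegral_enorm]
  have h2 : (timeMeasure T univ ^ ((1 : ℝ) / (1 : ℝ≥0∞).toReal - 1 / (2 : ℝ≥0∞).toReal))
      = ENNReal.ofReal √(max T 0) := by
    have : timeMeasure T univ = ENNReal.ofReal (max T 0) := by simp [timeMeasure]
    rw [this, ENNReal.ofReal_rpow_of_nonneg (le_max_right _ _) (by norm_num), Real.sqrt_eq_rpow]
    norm_num
  rw [h1, Lp.norm_def, mul_comm]
  have h3 := ENNReal.toReal_mono (ENNReal.mul_ne_top (Lp.memLp y).2.ne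
    (by rw [h2]; exact ENNReal.ofReal_ne_top)) h
  rwa [ENNReal.toReal_mul, h2, ENNReal.toReal_ofReal (Real.sqrt_nonneg _)] at h3

theorem memLp_of_continuous_of_bound {f : ℝ → H} (hf : Continuous f) (C : ℝ)
    (hC : ∀ t, ‖f t‖ ≤ C) : MemLp f 2 (timeMeasure T) :=
  MemLp.of_bound hf.aestronglyMeasurable C (Eventually.of_forall hC)

variable [InnerProductSpace ℝ H]

theorem integrable_smul_of_bounded {χ : ℝ → ℝ} (hχ : AEStronglyMeasurable χ (timeMeasure T))
    {C : ℝ} (hC : ∀ t, ‖χ t‖ ≤ C) (y : L2 T H) :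
    Integrable (fun t => χ t • y t) (timeMeasure T) :=
  (integrable_coe y).bdd_smul C hχ (Eventually.of_forall hC)

/-- The continuous linear map `y ↦ ∫ χ y dt` for a bounded measurable weight `χ`. -/
def weightedIntegral (χ : ℝ → ℝ) (hχ : AEStronglyMeasurable χ (timeMeasure T))
    (C : ℝ) (hC : ∀ t, ‖χ t‖ ≤ C) : L2 T H →L[ℝ] H :=
  LinearMap.mkContinuous
    { toFun := fun y => ∫ t, χ t • y t ∂(timeMeasure T)
      map_add' := fun a b => by
        rw [← integral_add (integrable_smul_of_bounded hχ hC a)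
          (integrable_smul_of_bounded hχ hC b)]
        refine integral_congr_ae ?_
        filter_upwards [Lp.coeFn_add a b] with t ht
        rw [ht, Pi.add_apply, smul_add]
      map_smul' := fun c a => by
        rw [RingHom.id_apply, ← integral_smul]
        refine integral_congr_ae ?_
        filter_upwards [Lp.coeFn_smul c a] with t ht
        rw [ht, Pi.smul_apply, smul_comm] }
    (C * √(max T 0)) (fun y => by
      have hC0 : 0 ≤ C := (norm_nonneg _).trans (hC 0)
      calc ‖∫ t, χ t • y t ∂(timeMeasure T)‖ ≤ ∫ t, ‖χ t • y t‖ ∂(timeMeasure T) :=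
            norm_integral_le_integral_norm _
        _ ≤ ∫ t, C * ‖y t‖ ∂(timeMeasure T) := by
            refine integral_mono (integrable_smul_of_bounded hχ hC y).norm
              ((integrable_coe y).norm.const_mul C) fun t => ?_
            simp only [norm_smul]
            exact mul_le_mul_of_nonneg_right (hC t) (norm_nonneg _)
        _ = C * ∫ t, ‖y t‖ ∂(timeMeasure T) := integral_const_mul _ _
        _ ≤ C * (√(max T 0) * ‖y‖) := by gcongr; exact integral_norm_le y
        _ = _ := by ring)

theorem weightedIntegral_apply (χ : ℝ → ℝ) (hχ : AEStronglyMeasurable χ (timeMeasure T))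
    (C : ℝ) (hC : ∀ t, ‖χ t‖ ≤ C) (y : L2 T H) :
    weightedIntegral χ hχ C hC y = ∫ t, χ t • y t ∂(timeMeasure T) := rfl

theorem norm_weightedIntegral_le (χ : ℝ → ℝ) (hχ : AEStronglyMeasurable χ (timeMeasure T))
    (C : ℝ) (hC : ∀ t, ‖χ t‖ ≤ C) (y : L2 T H) :
    ‖weightedIntegral χ hχ C hC y‖ ≤ C * √(max T 0) * ‖y‖ :=
  ContinuousLinearMap.le_of_opNorm_le _ (LinearMap.mkContinuous_norm_le _
    (mul_nonneg ((norm_nonneg _).trans (hC 0)) (Real.sqrt_nonneg _)) _) y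

/-- `v ↦ ∫₀ᵗ v`. -/
def evalPrim (t : ℝ) : L2 T H →L[ℝ] H :=
  weightedIntegral ((Ioc 0 t).indicator 1)
    (stronglyMeasurable_one.indicator measurableSet_Ioc).aestronglyMeasurable 1 (fun s => by
      by_cases h : s ∈ Ioc 0 t <;> simp [h])

theorem evalPrim_apply (t : ℝ) (v : L2 T H) :
    evalPrim t v = ∫ s in Ioc 0 t, v s ∂(timeMeasure T) := by
  rw [evalPrim, weightedIntegral_apply, ← integral_indicator measurableSet_Ioc]
  congr 1; ext s
  by_cases h : s ∈ Ioc 0 t <;> simp [h]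

theorem norm_evalPrim_le (t : ℝ) (v : L2 T H) : ‖evalPrim t v‖ ≤ √(max T 0) * ‖v‖ := by
  have h := norm_weightedIntegral_le ((Ioc 0 t).indicator 1)
    (stronglyMeasurable_one.indicator measurableSet_Ioc).aestronglyMeasurable 1 (fun s => by
      by_cases h : s ∈ Ioc 0 t <;> simp [h]) v
  rwa [one_mul] at h

theorem evalPrim_zero (v : L2 T H) : evalPrim 0 v = 0 := by
  simp [evalPrim_apply]

theorem continuous_evalPrim (v : L2 T H) : Continuous fun t => evalPrim t v := by
  -- For `t < 0` the set `Ioc 0 t` is empty, whereas an interval integral would change sign; the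
  -- upper limit is therefore clipped at `0`.
  have h : (fun t => evalPrim t v) = fun t => ∫ s in (0 : ℝ)..(max t 0), v s ∂(timeMeasure T) := by
    ext t
    rw [evalPrim_apply, intervalIntegral.integral_of_le (le_max_right _ _)]
    rcases le_total t 0 with ht | ht
    · simp [ht]
    · rw [max_eq_left ht]
  rw [h]
  exact (intervalIntegral.continuous_primitive
    (fun a b => (integrable_coe v).intervalIntegrable) 0).comp (by fun_prop)

theorem memLp_evalPrim (v : L2 T H) : MemLp (fun t => evalPrim t v) 2 (timeMeasure T) :=
  memLp_of_continuous_of_bound (continuous_evalPrim v) _ fun t => norm_evalPrim_le t v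

/-- The primitive vanishing at `0`, as an operator on `L²(0,T;H)`. -/
def prim : L2 T H →L[ℝ] L2 T H :=
  LinearMap.mkContinuous
    { toFun := fun v => (memLp_evalPrim v).toLp
      map_add' := fun v w => by
        rw [← MemLp.toLp_add]
        exact MemLp.toLp_congr _ _ (Eventually.of_forall fun t => map_add (evalPrim t) v w)
      map_smul' := fun c v => by
        rw [RingHom.id_apply, ← MemLp.toLp_const_smul]
        exact MemLp.toLp_congr _ _ (Eventually.of_forall fun t => map_smul (evalPrim t) c v) }
    ((measureUnivNNReal (timeMeasure T) : ℝ) ^ ((2 : ℝ≥0∞).toReal)⁻¹ * √(max T 0)) (fun v => by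
      rw [mul_assoc]
      refine Lp.norm_le_of_ae_bound (by positivity) ?_
      filter_upwards [(memLp_evalPrim v).coeFn_toLp] with t ht
      simp only [LinearMap.coe_mk, AddHom.coe_mk, ht]
      exact norm_evalPrim_le t v)

theorem coeFn_prim (v : L2 T H) : prim v =ᵐ[timeMeasure T] fun t => evalPrim t v :=
  (memLp_evalPrim v).coeFn_toLp

theorem integral_timeMeasure {E : Type*} [NormedAddCommGroup E] [NormedSpace ℝ E]
    (hT : 0 ≤ T) (g : ℝ → E) :
    ∫ t, g t ∂(timeMeasure T) = ∫ t in (0 : ℝ)..T, g t := by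
  rw [intervalIntegral.integral_of_le hT, integral_Ioc_eq_integral_Ioo]

theorem evalPrim_of_ae_eq {v : L2 T H} {f : ℝ → H} (hv : v =ᵐ[timeMeasure T] f) {t : ℝ}
    (ht : t ∈ Icc 0 T) : evalPrim t v = ∫ s in (0 : ℝ)..t, f s := by
  rw [evalPrim_apply, intervalIntegral.integral_of_le ht.1,
    integral_congr_ae (ae_restrict_of_ae hv), Measure.restrict_restrict measurableSet_Ioc]
  have : (Ioc 0 t ∩ Ioo 0 T : Set ℝ) =ᵐ[volume] Ioc 0 t := by
    have h1 : (Ioc 0 t ∩ Ioo 0 T : Set ℝ) =ᵐ[volume] (Ioc 0 t ∩ Ioc 0 T : Set ℝ) :=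
      (ae_eq_refl _).inter Ioo_ae_eq_Ioc
    rwa [inter_eq_left.2 (Ioc_subset_Ioc_right ht.2)] at h1
  rw [Measure.restrict_congr_set this]

theorem ae_mem_Ioo : ∀ᵐ t ∂(timeMeasure T), t ∈ Ioo 0 T := ae_restrict_mem measurableSet_Ioo

theorem hasDerivAt_integral {E : Type*} [NormedAddCommGroup E] [NormedSpace ℝ E] [CompleteSpace E]
    {f : ℝ → E} (hf : Continuous f) (t : ℝ) :
    HasDerivAt (fun t => ∫ s in (0 : ℝ)..t, f s) (f t) t :=
  (hf.integral_hasStrictDerivAt 0 t).hasDerivAt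

/-- Identities that are continuous in `v` need checking only for bounded continuous functions, whose
primitives are `C¹` and obey classical calculus. -/
theorem dense_continuous_induction [CompleteSpace H] {P : L2 T H → Prop} (hP : IsClosed {v | P v})
    (h : ∀ f : BoundedContinuousFunction ℝ H,
      P (BoundedContinuousFunction.toLp 2 (timeMeasure T) ℝ f)) (v : L2 T H) : P v :=
  (BoundedContinuousFunction.toLp_denseRange (E := H) (μ := timeMeasure T) ℝ
    (by norm_num : (2 : ℝ≥0∞) ≠ ⊤)).induction_on v hP h

theorem coeFn_prim_of_ae_eq {v : L2 T H} {f : ℝ → H} (hv : v =ᵐ[timeMeasure T] f) :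
    prim v =ᵐ[timeMeasure T] fun t => ∫ s in (0 : ℝ)..t, f s := by
  filter_upwards [coeFn_prim v, ae_mem_Ioo] with t ht htT
  rw [ht, evalPrim_of_ae_eq hv (Ioo_subset_Icc_self htT)]

/-- The chain rule for `½‖∫₀ᵗ v‖²`, integrated over `(0,T)`. -/
theorem inner_prim_self [CompleteSpace H] (hT : 0 ≤ T) (v : L2 T H) :
    inner ℝ v (prim v) = 1 / 2 * ‖evalPrim T v‖ ^ 2 := by
  refine dense_continuous_induction (P := fun v : L2 T H =>
    inner ℝ v (prim v) = 1 / 2 * ‖evalPrim T v‖ ^ 2)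
    (isClosed_eq (by fun_prop) (by fun_prop)) (fun f => ?_) v
  have hv := BoundedContinuousFunction.coeFn_toLp (p := 2) (timeMeasure T) (𝕜 := ℝ) f
  rw [L2.inner_def, evalPrim_of_ae_eq hv (right_mem_Icc.2 hT)]
  have h1 : ∀ t, HasDerivAt (fun t => 1 / 2 * ‖∫ s in (0 : ℝ)..t, f s‖ ^ 2)
      (inner ℝ (f t) (∫ s in (0 : ℝ)..t, f s)) t := fun t => by
    have := ((hasDerivAt_integral f.continuous t).norm_sq).const_mul (1 / 2 : ℝ)
    rwa [real_inner_comm, ← mul_assoc, one_div_mul_cancel two_ne_zero, one_mul] at this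
  have h2 := intervalIntegral.integral_eq_sub_of_hasDerivAt (a := 0) (b := T)
    (fun t _ => h1 t) (Continuous.intervalIntegrable (by
      exact f.continuous.inner (intervalIntegral.continuous_primitive
        (fun a b => f.continuous.intervalIntegrable a b) 0)) _ _)
  rw [intervalIntegral.integral_same, norm_zero] at h2
  rw [integral_congr_ae (g := fun t => inner ℝ (f t) (∫ s in (0 : ℝ)..t, f s)),
    integral_timeMeasure hT, h2]
  · ring
  · filter_upwards [hv, coeFn_prim_of_ae_eq hv] with t h3 h4
    rw [h3, h4]

theorem IsTestFunction.eq_zero_of_notMem {ψ : ℝ → ℝ} (hψ : IsTestFunction T ψ) {t : ℝ}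
    (ht : t ∉ Ioo 0 T) : ψ t = 0 :=
  image_eq_zero_of_notMem_tsupport fun h => ht (hψ.2.2 h)

theorem IsTestFunction.continuous_deriv {ψ : ℝ → ℝ} (hψ : IsTestFunction T ψ) :
    Continuous (deriv ψ) :=
  hψ.1.continuous_deriv (by simp)

/-- Makes both sides of the weak-derivative identity continuous on `L²`, for the density argument
and for the closedness of `H1`. -/
theorem exists_weightedIntegral {χ : ℝ → ℝ} (hc : Continuous χ) (hs : HasCompactSupport χ) :
    ∃ L : L2 T H →L[ℝ] H, ∀ y, L y = ∫ t, χ t • y t ∂(timeMeasure T) := by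
  obtain ⟨C, hC⟩ := hc.bounded_above_of_compact_support hs
  exact ⟨weightedIntegral χ hc.aestronglyMeasurable C hC, fun y => rfl⟩

/-- Integration by parts for continuous `f`, with boundary terms killed by the test function,
extended by density. -/
theorem isWeakDeriv_prim [CompleteSpace H] (hT : 0 ≤ T) (v : L2 T H) : IsWeakDeriv (prim v) v := by
  intro ψ hψ
  obtain ⟨L, hL⟩ := exists_weightedIntegral (T := T) (H := H) hψ.continuous_deriv hψ.2.1.deriv
  obtain ⟨M, hM⟩ := exists_weightedIntegral (T := T) (H := H) hψ.1.continuous hψ.2.1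
  rw [← hL, ← hM]
  refine dense_continuous_induction (P := fun v : L2 T H => L (prim v) = -M v)
    (isClosed_eq (by fun_prop) (by fun_prop)) (fun f => ?_) v
  have hv := BoundedContinuousFunction.coeFn_toLp (p := 2) (timeMeasure T) (𝕜 := ℝ) f
  rw [hL, hM]
  have hp : Continuous fun t => ∫ s in (0 : ℝ)..t, f s :=
    intervalIntegral.continuous_primitive (fun a b => f.continuous.intervalIntegrable a b) 0
  have h1 : ∀ t, HasDerivAt (fun t => ψ t • ∫ s in (0 : ℝ)..t, f s)
      (ψ t • f t + deriv ψ t • ∫ s in (0 : ℝ)..t, f s) t := fun t =>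
    ((hψ.1.differentiable (by simp)) t).hasDerivAt.smul (hasDerivAt_integral f.continuous t)
  have hc1 : Continuous fun t => ψ t • f t := hψ.1.continuous.smul f.continuous
  have hc2 : Continuous fun t => deriv ψ t • ∫ s in (0 : ℝ)..t, f s := hψ.continuous_deriv.smul hp
  have h2 := intervalIntegral.integral_eq_sub_of_hasDerivAt (a := 0) (b := T)
    (fun t _ => h1 t) ((hc1.add hc2).intervalIntegrable _ _)
  rw [intervalIntegral.integral_add (hc1.intervalIntegrable _ _) (hc2.intervalIntegrable _ _),
    intervalIntegral.integral_same, hψ.eq_zero_of_notMem (t := T) (by simp), zero_smul,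
    smul_zero, sub_zero, ← integral_timeMeasure hT, ← integral_timeMeasure hT] at h2
  rw [integral_congr_ae (g := fun t => deriv ψ t • ∫ s in (0 : ℝ)..t, f s),
    integral_congr_ae (f := fun t => ψ t • _) (g := fun t => ψ t • f t)]
  · exact eq_neg_of_add_eq_zero_right h2
  · filter_upwards [hv] with t h3
    rw [h3]
  · filter_upwards [coeFn_prim_of_ae_eq hv] with t h3
    rw [h3]

end TimeIntegrals

/-! ### Weak topology: boundedness, sequential compactness, convex closed sets. -/

section WeakTopology

variable {E : Type*} [NormedAddCommGroup E] [NormedSpace ℝ E]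

instance : T2Space (WeakSpace ℝ E) :=
  (NormedSpace.isEmbedding_inclusionInDoubleDualWeak ℝ E).t2Space

theorem continuous_weak_eval (f : E →L[ℝ] ℝ) :
    Continuous fun x : WeakSpace ℝ E => f ((toWeakSpace ℝ E).symm x) :=
  WeakBilin.eval_continuous (topDualPairing ℝ E).flip f

theorem tendsto_weak_iff {ι : Type*} {l : Filter ι} {x : ι → E} {y : E} :
    Tendsto (fun i => toWeakSpace ℝ E (x i)) l (𝓝 (toWeakSpace ℝ E y)) ↔
      ∀ f : E →L[ℝ] ℝ, Tendsto (fun i => f (x i)) l (𝓝 (f y)) := by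
  refine ⟨fun h f => ((continuous_weak_eval f).tendsto _).comp h, fun h => ?_⟩
  rw [(NormedSpace.isEmbedding_inclusionInDoubleDualWeak ℝ E).tendsto_nhds_iff,
    tendsto_iff_forall_eval_tendsto_topDualPairing]
  exact h

/-- Every functional is bounded on `K`, so Banach–Steinhaus applies to the image of `K` in the
bidual, where the norm is unchanged. -/
theorem exists_norm_le_of_isCompact_weak [CompleteSpace E] {K : Set (WeakSpace ℝ E)}
    (hK : IsCompact K) : ∃ R : ℝ, ∀ x ∈ K, ‖(toWeakSpace ℝ E).symm x‖ ≤ R := by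
  obtain ⟨R, hR⟩ := banach_steinhaus
    (g := fun x : K => NormedSpace.inclusionInDoubleDual ℝ E ((toWeakSpace ℝ E).symm x.1))
    fun f => by
      obtain ⟨C, hC⟩ := hK.exists_bound_of_continuousOn (continuous_weak_eval f).continuousOn
      exact ⟨C, fun x => hC x.1 x.2⟩
  refine ⟨R, fun x hx => ?_⟩
  have := hR ⟨x, hx⟩
  rwa [show ‖NormedSpace.inclusionInDoubleDual ℝ E ((toWeakSpace ℝ E).symm x)‖ = _ from
    (NormedSpace.inclusionInDoubleDualLi (𝕜 := ℝ) (E := E)).norm_map _] at this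

/-- The Riesz isomorphism turns weak into weak-* convergence, where the sequential Banach–Alaoglu
theorem for separable spaces applies. -/
theorem exists_subseq_tendsto_weak {E : Type*} [NormedAddCommGroup E] [InnerProductSpace ℝ E]
    [CompleteSpace E] [TopologicalSpace.SeparableSpace E] {x : ℕ → E} {R : ℝ}
    (hx : ∀ n, ‖x n‖ ≤ R) : ∃ (y : E) (k : ℕ → ℕ), StrictMono k ∧
      Tendsto (fun n => toWeakSpace ℝ E (x (k n))) atTop (𝓝 (toWeakSpace ℝ E y)) := by
  obtain ⟨ℓ, -, k, hk, hℓ⟩ := WeakDual.isSeqCompact_closedBall ℝ E 0 R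
    (x := fun n => StrongDual.toWeakDual (InnerProductSpace.toDual ℝ E (x n))) fun n => by
      rw [mem_preimage, mem_closedBall_zero_iff]
      exact ((InnerProductSpace.toDual ℝ E).norm_map _).trans_le (hx n)
  rw [tendsto_iff_forall_eval_tendsto_topDualPairing] at hℓ
  refine ⟨(InnerProductSpace.toDual ℝ E).symm (WeakDual.toStrongDual ℓ), k, hk,
    tendsto_weak_iff.2 fun f => ?_⟩
  have h := hℓ ((InnerProductSpace.toDual ℝ E).symm f)
  have h1 : ∀ z : E, f z = inner ℝ z ((InnerProductSpace.toDual ℝ E).symm f) := fun z => by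
    rw [real_inner_comm, InnerProductSpace.toDual_symm_apply]
  simp only [h1]
  rw [InnerProductSpace.toDual_symm_apply]
  exact h

/-- A convex and strongly closed set is weakly closed. -/
theorem isClosed_weak_of_convex {s : Set E} (hs : IsClosed s) (hc : Convex ℝ s) :
    IsClosed ((toWeakSpace ℝ E).symm ⁻¹' s) := by
  have h := hc.toWeakSpace_closure ℝ
  rw [hs.closure_eq] at h
  have h2 : (toWeakSpace ℝ E).symm ⁻¹' s = toWeakSpace ℝ E '' s := by
    ext x
    exact ⟨fun h => ⟨_, h, (toWeakSpace ℝ E).apply_symm_apply x⟩, by rintro ⟨z, hz, rfl⟩; exact hz⟩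
  rw [h2, h]
  exact isClosed_closure

end WeakTopology

theorem eqOn_Icc_of_ae_eq_timeMeasure {H : Type*} [NormedAddCommGroup H] {T : ℝ} (hT : 0 < T)
    {f g : ℝ → H}
    (h : f =ᵐ[timeMeasure T] g) (hf : ContinuousOn f (Icc 0 T)) (hg : ContinuousOn g (Icc 0 T)) :
    EqOn f g (Icc 0 T) := by
  refine Measure.eqOn_Icc_of_ae_eq volume hT.ne ?_ hf hg
  rwa [Measure.restrict_congr_set Ioo_ae_eq_Icc.symm]

/-! ### The space `H¹(0,T;H)`: continuous representatives, evaluation, chain rule. -/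

section Trajectories

variable {T : ℝ} {H : Type*} [NormedAddCommGroup H] [InnerProductSpace ℝ H]

theorem IsTestFunction.hasCompactSupport_of {ψ : ℝ → ℝ} {a b : ℝ}
    (hψ : ContDiff ℝ ∞ ψ) (ha : 0 < a) (hb : b < T) (h : ∀ t ∉ Icc a b, ψ t = 0) :
    IsTestFunction T ψ := by
  have hsub : tsupport ψ ⊆ Icc a b :=
    closure_minimal (fun t ht => by_contra fun hn => ht (h t hn)) isClosed_Icc
  exact ⟨hψ, HasCompactSupport.of_support_subset_isCompact isCompact_Icc
    ((subset_tsupport ψ).trans hsub),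
    hsub.trans fun t ht => ⟨ha.trans_le ht.1, ht.2.trans_lt hb⟩⟩

theorem IsTestFunction.exists_Icc (hT : 0 < T) {ψ : ℝ → ℝ} (hψ : IsTestFunction T ψ) :
    ∃ a b, 0 < a ∧ a ≤ b ∧ b < T ∧ ∀ t ∉ Icc a b, ψ t = 0 := by
  rcases (tsupport ψ).eq_empty_or_nonempty with h | h
  · refine ⟨T / 2, T / 2, by linarith, le_rfl, by linarith, fun t _ => ?_⟩
    exact image_eq_zero_of_notMem_tsupport (by simp [h])
  · have hc : IsCompact (tsupport ψ) := hψ.2.1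
    obtain ⟨a, ha, hal⟩ := hc.exists_isLeast h
    obtain ⟨b, hb, hbl⟩ := hc.exists_isGreatest h
    exact ⟨a, b, (hψ.2.2 ha).1, hal hb, (hψ.2.2 hb).2, fun t ht =>
      image_eq_zero_of_notMem_tsupport fun h' => ht ⟨hal h', hbl h'⟩⟩

theorem IsTestFunction.sub_const_mul {ψ η : ℝ → ℝ} (hψ : IsTestFunction T ψ)
    (hη : IsTestFunction T η) (m : ℝ) : IsTestFunction T (fun t => ψ t - m * η t) := by
  have hsub : tsupport (fun t => ψ t - m * η t) ⊆ tsupport ψ ∪ tsupport η := by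
    refine closure_minimal (fun t ht => by_contra fun hn => ht ?_)
      ((isClosed_tsupport _).union (isClosed_tsupport _))
    rw [mem_union, not_or] at hn
    simp [image_eq_zero_of_notMem_tsupport hn.1, image_eq_zero_of_notMem_tsupport hn.2]
  refine ⟨hψ.1.sub (contDiff_const.mul hη.1), ?_, hsub.trans (union_subset hψ.2.2 hη.2.2)⟩
  exact HasCompactSupport.of_support_subset_isCompact (IsCompact.union hψ.2.1 hη.2.1)
    ((subset_tsupport _).trans hsub)

/-- A test function with vanishing integral has a test function as primitive. -/
theorem IsTestFunction.primitive (hT : 0 < T) {θ : ℝ → ℝ} (hθ : IsTestFunction T θ)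
    (h0 : ∫ t in (0 : ℝ)..T, θ t = 0) :
    IsTestFunction T (fun t => ∫ s in (0 : ℝ)..t, θ s) ∧
      deriv (fun t => ∫ s in (0 : ℝ)..t, θ s) = θ := by
  have hc := hθ.1.continuous
  have hd : deriv (fun t => ∫ s in (0 : ℝ)..t, θ s) = θ :=
    funext fun t => (hasDerivAt_integral hc t).deriv
  refine ⟨?_, hd⟩
  obtain ⟨a, b, ha, hab, hb, hab0⟩ := hθ.exists_Icc hT
  refine IsTestFunction.hasCompactSupport_of
    (contDiff_infty_iff_deriv.2 ⟨fun t => (hasDerivAt_integral hc t).differentiableAt,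
      by rw [hd]; exact hθ.1⟩) ha hb fun t ht => ?_
  have hz : ∀ c d : ℝ, (∀ s ∈ uIoc c d, s ∉ Icc a b) → ∫ s in c..d, θ s = 0 := fun c d h => by
    rw [intervalIntegral.integral_congr_ae (g := fun _ => 0) (Eventually.of_forall fun s hs =>
      hab0 s (h s hs))]
    simp
  rcases lt_or_ge t a with hta | hta
  · refine hz 0 t fun s hs h => ?_
    rcases (mem_uIoc.1 hs) with h1 | h1 <;> linarith [h.1, h1.1, h1.2]
  · have htb : b < t := not_le.1 fun h => ht ⟨hta, h⟩
    rw [← intervalIntegral.integral_add_adjacent_intervals (b := T)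
      (hc.intervalIntegrable _ _) (hc.intervalIntegrable _ _), h0, zero_add]
    refine hz T t fun s hs h => ?_
    rcases (mem_uIoc.1 hs) with h1 | h1 <;> linarith [h.2, h1.1, h1.2]

theorem exists_isTestFunction_integral_eq_one (hT : 0 < T) :
    ∃ η, IsTestFunction T η ∧ ∫ t in (0 : ℝ)..T, η t = 1 := by
  let f : ContDiffBump (T / 2) := ⟨T / 8, T / 4, by linarith, by linarith⟩
  have hsub : tsupport (f.normed volume) ⊆ Ioo 0 T := by
    rw [f.tsupport_normed_eq]
    intro t ht
    have : |t - T / 2| ≤ T / 4 := by simpa [f, Real.dist_eq] using ht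
    rw [abs_le] at this
    constructor <;> linarith
  refine ⟨f.normed volume, ⟨f.contDiff_normed, f.hasCompactSupport_normed, hsub⟩, ?_⟩
  rw [← integral_timeMeasure hT.le, setIntegral_eq_integral_of_forall_compl_eq_zero]
  · exact f.integral_normed
  · exact fun t ht => image_eq_zero_of_notMem_tsupport fun h => ht (hsub h)

/-- A function with vanishing weak derivative is constant. -/
theorem exists_ae_eq_const_of_isWeakDeriv_zero [CompleteSpace H] (hT : 0 < T) {z : L2 T H}
    (hz : IsWeakDeriv z 0) : ∃ c, z =ᵐ[timeMeasure T] fun _ => c := by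
  obtain ⟨η, hη, hη1⟩ := exists_isTestFunction_integral_eq_one hT
  refine ⟨∫ t, η t • z t ∂(timeMeasure T), ?_⟩
  set c := ∫ t, η t • z t ∂(timeMeasure T) with hc
  have hi : Integrable (fun t => z t - c) (timeMeasure T) :=
    (integrable_coe z).sub (integrable_const c)
  -- The du Bois-Reymond argument: `ψ - (∫ψ) η` has zero integral, so it is the derivative of a test
  -- function and `z` annihilates it. Hence `z - c` annihilates every `ψ`.
  have key := isOpen_Ioo.ae_eq_zero_of_integral_contDiff_smul_eq_zero (U := Ioo 0 T)
    (hi.locallyIntegrable.locallyIntegrableOn _) fun ψ h1 h2 h3 => by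
      have hψ : IsTestFunction T ψ := ⟨h1, h2, h3⟩
      set m := ∫ t in (0 : ℝ)..T, ψ t with hm
      have hθ := hψ.sub_const_mul hη m
      have hiψ := hψ.1.continuous.intervalIntegrable (μ := volume) 0 T
      have hiη := hη.1.continuous.intervalIntegrable (μ := volume) 0 T
      obtain ⟨hΘ, hd⟩ := hθ.primitive hT (by
        rw [intervalIntegral.integral_sub hiψ (hiη.const_mul m),
          intervalIntegral.integral_const_mul, hη1, ← hm]; ring)
      have h4 := hz _ hΘ
      rw [hd] at h4
      have h5 : ∫ t, (∫ s in (0 : ℝ)..t, (ψ s - m * η s)) • (0 : L2 T H) t ∂(timeMeasure T)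
          = 0 := by
        refine integral_eq_zero_of_ae ?_
        filter_upwards [Lp.coeFn_zero H 2 (timeMeasure T)] with t ht
        rw [ht]; simp
      rw [h5, neg_zero] at h4
      have hi1 := integrable_smul_of_compactSupport hψ.1.continuous hψ.2.1 z
      have hi2 := integrable_smul_of_compactSupport hη.1.continuous hη.2.1 z
      simp only [sub_smul, mul_smul] at h4
      rw [integral_sub hi1 (show Integrable (fun t => m • η t • z t) (timeMeasure T) from hi2.smul m),
        integral_smul, ← hc, sub_eq_zero] at h4
      simp only [smul_sub]
      have hi3 : Integrable ψ (timeMeasure T) :=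
        (hψ.1.continuous.integrable_of_hasCompactSupport hψ.2.1).restrict
      rw [integral_sub hi1 (hi3.smul_const c), h4, integral_smul_const, integral_timeMeasure hT.le,
        ← hm, sub_self]
  filter_upwards [key, ae_mem_Ioo] with t h1 h2
  exact sub_eq_zero.1 (h1 h2)

theorem isWeakDeriv_const (hT : 0 ≤ T) (a : H) :
    IsWeakDeriv (Lp.const 2 (timeMeasure T) a) 0 := by
  intro ψ hψ
  have h5 : ∫ t, ψ t • (0 : L2 T H) t ∂(timeMeasure T) = 0 := by
    refine integral_eq_zero_of_ae ?_
    filter_upwards [Lp.coeFn_zero H 2 (timeMeasure T)] with t ht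
    rw [ht]; simp
  rw [h5, neg_zero, integral_congr_ae (g := fun t => deriv ψ t • a)]
  · have h0 : ∫ t, deriv ψ t ∂(timeMeasure T) = 0 := by
      rw [integral_timeMeasure hT, intervalIntegral.integral_deriv_eq_sub
        (fun t _ => (hψ.1.differentiable (by simp)) t)
        (hψ.continuous_deriv.intervalIntegrable _ _), hψ.eq_zero_of_notMem (by simp),
        hψ.eq_zero_of_notMem (by simp), sub_zero]
    -- In an incomplete space the Bochner integral is `0` by definition.
    by_cases hH : CompleteSpace H
    · rw [integral_smul_const, h0, zero_smul]
    · simp [integral, hH]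
  · filter_upwards [Lp.coeFn_const 2 (timeMeasure T) a] with t ht
    rw [ht]; rfl

/-- The inclusion `H¹(0,T;H) → L²(0,T;H)`. -/
def toL2 : H1 T H →L[ℝ] L2 T H := (WithLp.fstL 2 ℝ (L2 T H) (L2 T H)).comp (H1 T H).subtypeL

/-- The time derivative as an operator on `H¹(0,T;H)`. -/
def derivL : H1 T H →L[ℝ] L2 T H := (WithLp.sndL 2 ℝ (L2 T H) (L2 T H)).comp (H1 T H).subtypeL

theorem toL2_apply (y : H1 T H) : toL2 y = y.1.fst := rfl

theorem derivL_apply (y : H1 T H) : derivL y = timeDeriv y := rfl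

/-- The evaluation `y ↦ y(t)` on `H¹(0,T;H)`. -/
def evalAt (t : ℝ) : H1 T H →L[ℝ] H :=
  -- The difference `y - prim y'` is a.e. constant, and its mean over `(0,T)` is `y(0)`. Written
  -- this way, evaluation is visibly linear and continuous, hence weakly continuous.
  T⁻¹ • (evalPrim T).comp (toL2 - prim.comp derivL) + (evalPrim t).comp derivL

theorem evalAt_eq_add (y : H1 T H) (t : ℝ) :
    evalAt t y = evalAt 0 y + evalPrim t (timeDeriv y) := by
  simp [evalAt, evalPrim_zero, derivL_apply]

theorem continuous_evalAt (y : H1 T H) : Continuous fun t => evalAt t y := by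
  rw [funext (evalAt_eq_add y)]
  exact continuous_const.add (continuous_evalPrim _)

/-- `y - prim y'` has zero weak derivative, so it is a constant, which the mean in `evalAt`
recovers. -/
theorem ae_eq_evalAt [CompleteSpace H] (hT : 0 < T) (y : H1 T H) :
    y.1.fst =ᵐ[timeMeasure T] fun t => evalAt t y := by
  have hw : IsWeakDeriv (y.1.fst - prim (timeDeriv y)) 0 := by
    have h1 : (WithLp.toLp 2 (prim (timeDeriv y), timeDeriv y) : WithLp 2 (L2 T H × L2 T H))
        ∈ H1 T H := isWeakDeriv_prim hT.le (timeDeriv y)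
    have h2 := (H1 T H).sub_mem y.2 h1
    have h3 : IsWeakDeriv (y.1.fst - prim (timeDeriv y)) (timeDeriv y - timeDeriv y) := h2
    rwa [sub_self] at h3
  obtain ⟨c, hc⟩ := exists_ae_eq_const_of_isWeakDeriv_zero hT hw
  have h0 : evalAt 0 y = c := by
    have : evalAt 0 y = T⁻¹ • evalPrim T (y.1.fst - prim (timeDeriv y)) := by
      simp [evalAt, evalPrim_zero, derivL_apply, toL2_apply]
    rw [this, evalPrim_of_ae_eq hc (right_mem_Icc.2 hT.le)]
    simp [smul_smul, hT.ne']
  filter_upwards [hc, Lp.coeFn_sub y.1.fst (prim (timeDeriv y)), coeFn_prim (timeDeriv y)]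
    with t h1 h2 h3
  rw [evalAt_eq_add, h0, ← h3, ← h1, h2]
  simp

theorem rep_spec [CompleteSpace H] (hT : 0 < T) (y : H1 T H) :
    ContinuousOn (rep y) (Icc 0 T) ∧ y.1.fst =ᵐ[timeMeasure T] rep y := by
  have h : ∃ f : ℝ → H, ContinuousOn f (Icc 0 T) ∧ y.1.fst =ᵐ[timeMeasure T] f :=
    ⟨_, (continuous_evalAt y).continuousOn, ae_eq_evalAt hT y⟩
  rw [rep, dif_pos h]
  exact h.choose_spec

/-- Replaces the representative picked by choice with a continuous linear operator. -/
theorem rep_eq_evalAt [CompleteSpace H] (hT : 0 < T) (y : H1 T H) {t : ℝ} (ht : t ∈ Icc 0 T) :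
    rep y t = evalAt t y :=
  eqOn_Icc_of_ae_eq_timeMeasure hT ((rep_spec hT y).2.symm.trans (ae_eq_evalAt hT y))
    (rep_spec hT y).1 (continuous_evalAt y).continuousOn ht

theorem toL2_eq [CompleteSpace H] (hT : 0 < T) (y : H1 T H) :
    toL2 y = Lp.const 2 (timeMeasure T) (evalAt 0 y) + prim (timeDeriv y) := by
  refine Lp.ext ?_
  filter_upwards [ae_eq_evalAt hT y, Lp.coeFn_const 2 (timeMeasure T) (evalAt 0 y),
    coeFn_prim (timeDeriv y), Lp.coeFn_add (Lp.const 2 (timeMeasure T) (evalAt 0 y))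
      (prim (timeDeriv y))] with t h1 h2 h3 h4
  rw [h4, Pi.add_apply, h2, h3, toL2_apply, h1, evalAt_eq_add]
  rfl

theorem evalPrim_eq_integral (hT : 0 ≤ T) (v : L2 T H) :
    evalPrim T v = ∫ t, v t ∂(timeMeasure T) := by
  rw [evalPrim_of_ae_eq (ae_eq_refl _) (right_mem_Icc.2 hT), integral_timeMeasure hT]

theorem inner_const [CompleteSpace H] (hT : 0 ≤ T) (v : L2 T H) (a : H) :
    inner ℝ v (Lp.const 2 (timeMeasure T) a) = inner ℝ (evalPrim T v) a := by
  rw [L2.inner_def, evalPrim_eq_integral hT, real_inner_comm, ← integral_inner (integrable_coe v)]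
  refine integral_congr_ae ?_
  filter_upwards [Lp.coeFn_const 2 (timeMeasure T) a] with t ht
  rw [ht, real_inner_comm]; rfl

/-- The integrated chain rule `∫ (y', y) = ½‖y(T)‖² - ½‖y(0)‖²`. -/
theorem inner_timeDeriv_self [CompleteSpace H] (hT : 0 < T) (y : H1 T H) :
    inner ℝ (timeDeriv y) (toL2 y) = 1 / 2 * ‖evalAt T y‖ ^ 2 - 1 / 2 * ‖evalAt 0 y‖ ^ 2 := by
  rw [toL2_eq hT, inner_add_right, inner_const hT.le, inner_prim_self hT.le, evalAt_eq_add y T,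
    norm_add_sq_real, real_inner_comm]
  ring

/-- The element of `H¹(0,T;H)` with a given initial value and a given derivative. -/
def ofDeriv [CompleteSpace H] (hT : 0 ≤ T) (a : H) (v : L2 T H) : H1 T H :=
  ⟨WithLp.toLp 2 (Lp.const 2 (timeMeasure T) a, 0) + WithLp.toLp 2 (prim v, v),
    (H1 T H).add_mem (isWeakDeriv_const hT a) (isWeakDeriv_prim hT v)⟩

theorem timeDeriv_ofDeriv [CompleteSpace H] (hT : 0 ≤ T) (a : H) (v : L2 T H) :
    timeDeriv (ofDeriv hT a v) = v := by
  simp [timeDeriv, ofDeriv]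

theorem toL2_ofDeriv [CompleteSpace H] (hT : 0 ≤ T) (a : H) (v : L2 T H) :
    toL2 (ofDeriv hT a v) = Lp.const 2 (timeMeasure T) a + prim v := by
  simp [toL2_apply, ofDeriv]

theorem evalAt_zero_ofDeriv [CompleteSpace H] (hT : 0 < T) (a : H) (v : L2 T H) :
    evalAt 0 (ofDeriv hT.le a v) = a := by
  simp only [evalAt, evalPrim_zero, _root_.add_apply, _root_.smul_apply,
    ContinuousLinearMap.comp_apply, _root_.sub_apply, derivL_apply, toL2_ofDeriv,
    timeDeriv_ofDeriv, add_sub_cancel_right, add_zero]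
  rw [evalPrim_of_ae_eq (Lp.coeFn_const 2 (timeMeasure T) a) (right_mem_Icc.2 hT.le)]
  simp [smul_smul, hT.ne']

theorem isClosed_H1 : IsClosed (H1 T H : Set (WithLp 2 (L2 T H × L2 T H))) := by
  have : (H1 T H : Set (WithLp 2 (L2 T H × L2 T H))) = {p | IsWeakDeriv p.fst p.snd} := rfl
  rw [this]
  simp only [IsWeakDeriv, ofPred_forall]
  refine isClosed_iInter fun ψ => isClosed_iInter fun hψ => ?_
  obtain ⟨L, hL⟩ := exists_weightedIntegral (T := T) (H := H) hψ.continuous_deriv hψ.2.1.deriv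
  obtain ⟨M, hM⟩ := exists_weightedIntegral (T := T) (H := H) hψ.1.continuous hψ.2.1
  simp only [← hL, ← hM]
  exact isClosed_eq (L.continuous.comp (WithLp.fstL 2 ℝ _ _).continuous)
    (M.continuous.comp (WithLp.sndL 2 ℝ _ _).continuous).neg

instance [CompleteSpace H] : CompleteSpace (H1 T H) := isClosed_H1.completeSpace_coe

instance [TopologicalSpace.SeparableSpace H] : TopologicalSpace.SeparableSpace (H1 T H) := by
  have : Fact ((2 : ℝ≥0∞) ≠ ⊤) := ⟨by norm_num⟩
  have : SecondCountableTopology (L2 T H) := Lp.SecondCountableTopology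
  have : SecondCountableTopology (WithLp 2 (L2 T H × L2 T H)) :=
    (WithLp.homeomorphProd 2 (L2 T H) (L2 T H)).secondCountableTopology
  infer_instance

theorem norm_H1_le (y : H1 T H) : ‖y‖ ≤ ‖toL2 y‖ + ‖timeDeriv y‖ := by
  have h : ‖y‖ ^ 2 = ‖toL2 y‖ ^ 2 + ‖timeDeriv y‖ ^ 2 := WithLp.prod_norm_sq_eq_of_L2 y.1
  nlinarith [norm_nonneg y, norm_nonneg (toL2 y), norm_nonneg (timeDeriv y)]

/-- `τ`-compact sets have bounded state component. -/
theorem exists_norm_state_le [CompleteSpace H] {K : Set (ControlState T H)} (hK : IsCompact K) :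
    ∃ R : ℝ, ∀ p ∈ K, ‖p.state‖ ≤ R := by
  obtain ⟨R, hR⟩ := exists_norm_le_of_isCompact_weak (hK.image continuous_snd)
  exact ⟨R, fun p hp => hR p.2 (mem_image_of_mem _ hp)⟩

/-- Compactness need not yield subsequences in a weak topology. Here the controls lie in a compact
subset of a metric space, the states are bounded in a separable Hilbert space, and `K` is closed. -/
theorem isSeqCompact_of_isCompact_controlState [CompleteSpace H]
    [TopologicalSpace.SeparableSpace H] {K : Set (ControlState T H)} (hK : IsCompact K) :
    IsSeqCompact K := by
  intro p hp
  obtain ⟨R, hR⟩ := exists_norm_state_le hK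
  obtain ⟨u, -, k, hk, hu⟩ := (hK.image continuous_fst).isSeqCompact
    (x := fun n => (p n).1) fun n => mem_image_of_mem _ (hp n)
  obtain ⟨y, m, hm, hy⟩ := exists_subseq_tendsto_weak (x := fun n => (p (k n)).state)
    (fun n => hR _ (hp _))
  have ht : Tendsto (p ∘ (k ∘ m)) atTop (𝓝 (u, toWeakSpace ℝ (H1 T H) y)) :=
    (hu.comp hm.tendsto_atTop).prodMk_nhds hy
  exact ⟨_, hK.isClosed.mem_of_tendsto ht (Eventually.of_forall fun n => hp _), k ∘ m,
    hk.comp hm, ht⟩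

end Trajectories

/-! ### Convex analysis: affine minorants, conjugates, Fenchel equality, excess. -/

section ConvexAnalysis

variable {H : Type*} [NormedAddCommGroup H] [InnerProductSpace ℝ H] {φ : H → EReal}

theorem IsConvexProperLsc.coe_toReal (hφ : IsConvexProperLsc φ) {x : H} (hx : φ x ≠ ⊤) :
    ((φ x).toReal : EReal) = φ x :=
  EReal.coe_toReal hx (hφ.ne_bot x)

theorem IsConvexProperLsc.le_combo (hφ : IsConvexProperLsc φ) {x y : H} {r q s t : ℝ}
    (hx : φ x ≤ r) (hy : φ y ≤ q) (hs : 0 ≤ s) (ht : 0 ≤ t) (hst : s + t = 1) :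
    φ (s • x + t • y) ≤ ((s * r + t * q : ℝ) : EReal) := by
  refine (hφ.convex x y s t hs ht hst).trans ?_
  rw [EReal.coe_add, EReal.coe_mul, EReal.coe_mul]
  have hs' : (0 : EReal) ≤ s := by exact_mod_cast hs
  have ht' : (0 : EReal) ≤ t := by exact_mod_cast ht
  exact add_le_add (mul_le_mul_of_nonneg_left hx hs') (mul_le_mul_of_nonneg_left hy ht')

/-- A convex, proper and lower semicontinuous function has a continuous affine minorant. -/
theorem IsConvexProperLsc.exists_affine_le [CompleteSpace H] (hφ : IsConvexProperLsc φ) :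
    ∃ (a : H) (b : ℝ), ∀ x, ((inner ℝ a x + b : ℝ) : EReal) ≤ φ x := by
  obtain ⟨y, hy⟩ := hφ.proper
  set c := (φ y).toReal with hc
  have hyc : φ y = c := (hφ.coe_toReal hy).symm
  let S : Set (H × ℝ) := {p | φ p.1 ≤ (p.2 : EReal)}
  have hScl : IsClosed S := by
    have h1 := hφ.lsc.isClosed_epigraph
    exact h1.preimage (f := fun p : H × ℝ => (p.1, (p.2 : EReal)))
      (continuous_fst.prodMk (continuous_coe_real_ereal.comp continuous_snd))
  have hSconv : Convex ℝ S := fun p hp q hq s t hs ht hst => by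
    exact hφ.le_combo hp hq hs ht hst
  -- A point strictly below the graph is separated from the closed convex epigraph. Since `(y, c)`
  -- lies on the other side, the hyperplane is not vertical (`α > 0`) and solves for an affine
  -- minorant.
  have hnot : (y, c - 1) ∉ S := fun h => by
    have h' : φ y ≤ ((c - 1 : ℝ) : EReal) := h
    rw [hyc, EReal.coe_le_coe_iff] at h'
    linarith
  obtain ⟨f, s, hfs, hf⟩ := geometric_hahn_banach_point_closed hSconv hScl hnot
  set α := f (0, 1) with hα
  have hdec : ∀ x r, f (x, r) = f (x, 0) + r * α := fun x r => by
    rw [show (x, r) = (x, (0 : ℝ)) + r • ((0 : H), (1 : ℝ)) by simp, map_add, map_smul,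
      smul_eq_mul]
  have hαpos : 0 < α := by
    have h1 := hfs.trans (hf (y, c) hyc.le)
    rw [hdec y, hdec y c] at h1
    linarith
  refine ⟨(InnerProductSpace.toDual ℝ H).symm
    (-α⁻¹ • f.comp (ContinuousLinearMap.inl ℝ H ℝ)), α⁻¹ * s, fun x => ?_⟩
  by_cases hx : φ x = ⊤
  · rw [hx]; exact le_top
  rw [← hφ.coe_toReal hx, EReal.coe_le_coe_iff, InnerProductSpace.toDual_symm_apply]
  have h1 := hf (x, (φ x).toReal) (hφ.coe_toReal hx).ge
  rw [hdec] at h1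
  have h2 : (-α⁻¹ • f.comp (ContinuousLinearMap.inl ℝ H ℝ)) x + α⁻¹ * s
      = α⁻¹ * (s - f (x, 0)) := by
    simp; ring
  rw [h2, inv_mul_le_iff₀ hαpos]
  linarith

theorem le_conjugate {x : H} {r : ℝ} (hx : φ x = r) (ξ : H) :
    ((inner ℝ ξ x - r : ℝ) : EReal) ≤ conjugate φ ξ := by
  refine le_trans ?_ (le_iSup _ x)
  rw [hx, EReal.coe_sub]

theorem IsConvexProperLsc.conjugate_le_iff (hφ : IsConvexProperLsc φ) {ξ : H} {c : ℝ} :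
    conjugate φ ξ ≤ c ↔ ∀ x, ((inner ℝ ξ x - c : ℝ) : EReal) ≤ φ x := by
  rw [conjugate, iSup_le_iff]
  refine forall_congr' fun x => ?_
  by_cases hx : φ x = ⊤
  · simp [hx]
  · rw [← hφ.coe_toReal hx, ← EReal.coe_sub, EReal.coe_le_coe_iff, EReal.coe_le_coe_iff]
    exact sub_le_comm

theorem IsConvexProperLsc.conjugate [CompleteSpace H] (hφ : IsConvexProperLsc φ) :
    IsConvexProperLsc (conjugate φ) := by
  obtain ⟨y, hy⟩ := hφ.proper
  have hyc := (hφ.coe_toReal hy).symm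
  have hbot : ∀ ξ, BEN.conjugate φ ξ ≠ ⊥ := fun ξ h => by
    have := le_conjugate hyc ξ
    rw [h, le_bot_iff] at this
    exact EReal.coe_ne_bot _ this
  refine ⟨hbot, ?_, ?_, ?_⟩
  -- The slope of an affine minorant of `φ` is a point where `φ*` is finite.
  · obtain ⟨a, b, hab⟩ := hφ.exists_affine_le
    refine ⟨a, ne_top_of_le_ne_top (EReal.coe_ne_top (-b)) (hφ.conjugate_le_iff.2 fun x => ?_)⟩
    simpa using hab x
  · intro ξ η s t hs ht hst
    refine iSup_le fun x => ?_
    by_cases hx : φ x = ⊤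
    · simp [hx]
    have hs' : (0 : EReal) ≤ s := by exact_mod_cast hs
    have ht' : (0 : EReal) ≤ t := by exact_mod_cast ht
    have hxr := (hφ.coe_toReal hx).symm
    have h1 := add_le_add (mul_le_mul_of_nonneg_left (le_conjugate hxr ξ) hs')
      (mul_le_mul_of_nonneg_left (le_conjugate hxr η) ht')
    refine le_trans (le_of_eq ?_) h1
    rw [hxr, EReal.toReal_coe, ← EReal.coe_sub, ← EReal.coe_mul, ← EReal.coe_mul,
      ← EReal.coe_add, inner_add_left, real_inner_smul_left, real_inner_smul_left]
    congr 1
    linear_combination (φ x).toReal * hst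
  · refine lowerSemicontinuous_iSup fun x => ?_
    by_cases hx : φ x = ⊤
    · simpa [hx] using lowerSemicontinuous_const
    · rw [← hφ.coe_toReal hx]
      simp only [← EReal.coe_sub]
      exact Continuous.lowerSemicontinuous (continuous_coe_real_ereal.comp (by fun_prop))

theorem mem_subdifferential_iff (hφ : IsConvexProperLsc φ) {x ξ : H} :
    ξ ∈ subdifferential φ x ↔
      φ x ≠ ⊤ ∧ ∀ z, (((φ x).toReal + inner ℝ ξ (z - x) : ℝ) : EReal) ≤ φ z := by
  rw [subdifferential, mem_ofPred_eq, lt_top_iff_ne_top]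
  refine and_congr_right fun hx => forall_congr' fun z => ?_
  rw [← hφ.coe_toReal hx, EReal.le_sub_iff_add_le (Or.inl (EReal.coe_ne_bot _))
    (Or.inl (EReal.coe_ne_top _)), ← EReal.coe_add, add_comm, EReal.toReal_coe]

/-- Fenchel equality on the graph of the subdifferential. -/
theorem conjugate_eq_of_mem_subdifferential (hφ : IsConvexProperLsc φ) {x ξ : H}
    (h : ξ ∈ subdifferential φ x) :
    conjugate φ ξ = ((inner ℝ ξ x - (φ x).toReal : ℝ) : EReal) := by
  obtain ⟨hx, h⟩ := (mem_subdifferential_iff hφ).1 h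
  refine le_antisymm (hφ.conjugate_le_iff.2 fun z => ?_) (le_conjugate (hφ.coe_toReal hx).symm ξ)
  convert h z using 2
  rw [inner_sub_right]; ring

theorem mem_subdifferential_of_fenchel_eq (hφ : IsConvexProperLsc φ) {x ξ : H} (hx : φ x ≠ ⊤)
    {c : ℝ} (hξ : conjugate φ ξ = c) (h : (φ x).toReal + c = inner ℝ ξ x) :
    ξ ∈ subdifferential φ x := by
  refine (mem_subdifferential_iff hφ).2 ⟨hx, fun z => ?_⟩
  have h1 := hφ.conjugate_le_iff.1 hξ.le z
  convert h1 using 2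
  rw [inner_sub_right]; linarith

/-- The difference between `φ` and an affine minorant. -/
def excess (φ : H → EReal) (a : H) (b : ℝ) (x : H) : ℝ≥0∞ :=
  (φ x - ((inner ℝ a x + b : ℝ) : EReal)).toENNReal

theorem excess_eq_top_iff (a : H) (b : ℝ) (x : H) : excess φ a b x = ⊤ ↔ φ x = ⊤ := by
  rw [excess, EReal.toENNReal_eq_top_iff]
  induction h : φ x with
  | bot => simp
  | top => rw [EReal.top_sub_coe]
  | coe r => rw [← EReal.coe_sub]; simp [-EReal.coe_sub]

theorem excess_of_eq_coe {a : H} {b : ℝ} {x : H} {r : ℝ} (h : φ x = r) :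
    excess φ a b x = ENNReal.ofReal (r - (inner ℝ a x + b)) := by
  rw [excess, h, ← EReal.coe_sub, EReal.real_coe_toENNReal]

theorem excess_le_of_le {a : H} {b : ℝ} {x : H} {r : ℝ} (h : φ x ≤ r) :
    excess φ a b x ≤ ENNReal.ofReal (r - (inner ℝ a x + b)) := by
  rw [excess, ← EReal.real_coe_toENNReal, EReal.coe_sub]
  exact EReal.toENNReal_le_toENNReal (EReal.sub_le_sub h le_rfl)

theorem lowerSemicontinuous_excess (hφ : IsConvexProperLsc φ) (a : H) (b : ℝ) :
    LowerSemicontinuous (excess φ a b) := by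
  have h1 : LowerSemicontinuous fun x => φ x + ((-(inner ℝ a x + b) : ℝ) : EReal) :=
    hφ.lsc.add' (Continuous.lowerSemicontinuous (continuous_coe_real_ereal.comp (by fun_prop)))
      fun x => EReal.continuousAt_add (Or.inr (EReal.coe_ne_bot _)) (Or.inr (EReal.coe_ne_top _))
  have h2 : excess φ a b = EReal.toENNReal ∘ fun x => φ x + ((-(inner ℝ a x + b) : ℝ) : EReal) := by
    ext x
    simp only [excess, Function.comp, EReal.coe_neg, sub_eq_add_neg]
  rw [h2]
  exact EReal.continuous_toENNReal.comp_lowerSemicontinuous h1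
    fun x y h => EReal.toENNReal_le_toENNReal h

theorem excess_combo_le (hφ : IsConvexProperLsc φ) {a : H} {b : ℝ}
    (hab : ∀ x, ((inner ℝ a x + b : ℝ) : EReal) ≤ φ x) (x y : H) {s t : ℝ} (hs : 0 ≤ s)
    (ht : 0 ≤ t) (hst : s + t = 1) :
    excess φ a b (s • x + t • y)
      ≤ ENNReal.ofReal s * excess φ a b x + ENNReal.ofReal t * excess φ a b y := by
  -- Zero weights are set apart: `0 * ⊤ = 0`, so an infinite value makes the right side infinite
  -- only under a positive weight.
  rcases hs.eq_or_lt with rfl | hs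
  · obtain rfl : t = 1 := by linarith
    simp
  rcases ht.eq_or_lt with rfl | ht
  · obtain rfl : s = 1 := by linarith
    simp
  by_cases hx : φ x = ⊤
  · rw [(excess_eq_top_iff a b x).2 hx, ENNReal.mul_top (by simpa using hs)]; simp
  by_cases hy : φ y = ⊤
  · rw [(excess_eq_top_iff a b y).2 hy, ENNReal.mul_top (by simpa using ht)]; simp
  have hx' := (hφ.coe_toReal hx).symm
  have hy' := (hφ.coe_toReal hy).symm
  have h1 := hab x
  have h2 := hab y
  rw [hx', EReal.coe_le_coe_iff] at h1
  rw [hy', EReal.coe_le_coe_iff] at h2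
  rw [excess_of_eq_coe hx', excess_of_eq_coe hy', ← ENNReal.ofReal_mul hs.le,
    ← ENNReal.ofReal_mul ht.le, ← ENNReal.ofReal_add (mul_nonneg hs.le (by linarith))
      (mul_nonneg ht.le (by linarith))]
  refine (excess_le_of_le (hφ.le_combo hx'.le hy'.le hs.le ht.le hst)).trans
    (ENNReal.ofReal_le_ofReal (le_of_eq ?_))
  rw [inner_add_right, real_inner_smul_right, real_inner_smul_right]
  linear_combination b * hst

end ConvexAnalysis

/-! ### Integral functionals of the excess: convexity and weak lower semicontinuity. -/

section IntegralFunctional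

variable {T : ℝ} {H : Type*} [NormedAddCommGroup H] [InnerProductSpace ℝ H] {φ : H → EReal}

/-- The integral of the excess of `φ` over an affine minorant along `z ∈ L²(0,T;H)`. -/
def excessIntegral (φ : H → EReal) (a : H) (b : ℝ) (z : L2 T H) : ℝ≥0∞ :=
  ∫⁻ t, excess φ a b (z t) ∂(timeMeasure T)

theorem aemeasurable_excess (hφ : IsConvexProperLsc φ) (a : H) (b : ℝ) (z : L2 T H) :
    AEMeasurable (fun t => excess φ a b (z t)) (timeMeasure T) := by
  let : MeasurableSpace H := borel H
  have : BorelSpace H := ⟨rfl⟩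
  exact (lowerSemicontinuous_excess hφ a b).measurable.comp_aemeasurable
    (Lp.aestronglyMeasurable z).aemeasurable

theorem excessIntegral_combo_le (hφ : IsConvexProperLsc φ) {a : H} {b : ℝ}
    (hab : ∀ x, ((inner ℝ a x + b : ℝ) : EReal) ≤ φ x) (y z : L2 T H) {s t : ℝ} (hs : 0 ≤ s)
    (ht : 0 ≤ t) (hst : s + t = 1) :
    excessIntegral φ a b (s • y + t • z)
      ≤ ENNReal.ofReal s * excessIntegral φ a b y + ENNReal.ofReal t * excessIntegral φ a b z := by
  rw [excessIntegral, excessIntegral, excessIntegral,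
    ← lintegral_const_mul'' _ (aemeasurable_excess hφ a b y),
    ← lintegral_const_mul'' _ (aemeasurable_excess hφ a b z),
    ← lintegral_add_left' ((aemeasurable_excess hφ a b y).const_mul _)]
  refine lintegral_mono_ae ?_
  filter_upwards [Lp.coeFn_add (s • y) (t • z), Lp.coeFn_smul s y, Lp.coeFn_smul t z]
    with r h1 h2 h3
  rw [h1, Pi.add_apply, h2, h3]
  exact excess_combo_le hφ hab _ _ hs ht hst

/-- An `L²`-convergent sequence has an a.e. convergent subsequence; semicontinuity of the excess and
Fatou conclude. -/
theorem isClosed_excessIntegral_le (hφ : IsConvexProperLsc φ) (a : H) (b : ℝ) (c : ℝ≥0∞) :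
    IsClosed {z : L2 T H | excessIntegral φ a b z ≤ c} := by
  refine IsSeqClosed.isClosed fun z z₀ hz hlim => ?_
  obtain ⟨k, -, hk⟩ := (tendstoInMeasure_of_tendsto_Lp hlim).exists_seq_tendsto_ae
  calc excessIntegral φ a b z₀
      ≤ ∫⁻ t, liminf (fun n => excess φ a b (z (k n) t)) atTop ∂(timeMeasure T) := by
        refine lintegral_mono_ae ?_
        filter_upwards [hk] with t ht
        exact ((lowerSemicontinuous_iff_le_liminf.1 (lowerSemicontinuous_excess hφ a b)) _).trans
          (le_trans (liminf_le_liminf_of_le ht) le_rfl)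
    _ ≤ liminf (fun n => ∫⁻ t, excess φ a b (z (k n) t) ∂(timeMeasure T)) atTop :=
        lintegral_liminf_le' fun n => aemeasurable_excess hφ a b _
    _ ≤ c := liminf_le_of_frequently_le' (Eventually.of_forall fun n => hz (k n)).frequently

theorem lowerSemicontinuous_weak_excessIntegral (hφ : IsConvexProperLsc φ) {a : H} {b : ℝ}
    (hab : ∀ x, ((inner ℝ a x + b : ℝ) : EReal) ≤ φ x) :
    LowerSemicontinuous fun z : WeakSpace ℝ (L2 T H) =>
      excessIntegral φ a b ((toWeakSpace ℝ (L2 T H)).symm z) := by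
  refine lowerSemicontinuous_iff_isClosed_preimage.2 fun c => ?_
  refine isClosed_weak_of_convex (isClosed_excessIntegral_le hφ a b c)
    fun y hy z hz s t hs ht hst => ?_
  refine (excessIntegral_combo_le hφ hab y z hs ht hst).trans ?_
  calc _ ≤ ENNReal.ofReal s * c + ENNReal.ofReal t * c := by
        gcongr
        · exact hy
        · exact hz
    _ = c := by rw [← add_mul, ← ENNReal.ofReal_add hs ht, hst]; simp

theorem integrable_affine (a : H) (b : ℝ) (z : L2 T H) :
    Integrable (fun t => inner ℝ a (z t) + b) (timeMeasure T) :=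
  ((integrable_coe z).const_inner (𝕜 := ℝ) a).add (integrable_const b)

theorem integral_affine (hT : 0 ≤ T) [CompleteSpace H] (a : H) (b : ℝ) (z : L2 T H) :
    ∫ t, (inner ℝ a (z t) + b) ∂(timeMeasure T) = inner ℝ a (evalPrim T z) + T * b := by
  rw [integral_add ((integrable_coe z).const_inner a) (integrable_const b),
    integral_inner (integrable_coe z), evalPrim_eq_integral hT]
  simp [timeMeasure, hT]

/-- The affine minorant is integrable along `z`, so a finite excess integral amounts to `φ(w) ∈ L¹`;
`excessIntegral_ne_top_of_memL1` is the converse. The function `w` is a pointwise representative of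
the class `z`. -/
theorem memL1_of_excessIntegral_ne_top (hφ : IsConvexProperLsc φ) {a : H} {b : ℝ}
    (hab : ∀ x, ((inner ℝ a x + b : ℝ) : EReal) ≤ φ x) {z : L2 T H} {w : ℝ → H}
    (hw : z =ᵐ[timeMeasure T] w) (h : excessIntegral φ a b z ≠ ⊤) :
    MemL1 T (fun t => φ (w t)) := by
  have hfin : ∀ᵐ t ∂(timeMeasure T), φ (w t) ≠ ⊤ ∧ φ (w t) ≠ ⊥ := by
    filter_upwards [ae_lt_top' (aemeasurable_excess hφ a b z) h, hw] with t ht hwt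
    rw [hwt] at ht
    exact ⟨fun h => ht.ne ((excess_eq_top_iff a b _).2 h), hφ.ne_bot _⟩
  refine ⟨hfin, ?_⟩
  have h1 := (integrable_toReal_of_lintegral_ne_top (aemeasurable_excess hφ a b z) h).add
    (integrable_affine a b z)
  refine h1.congr ?_
  filter_upwards [hw, hfin] with t ht hft
  have h2 := (hφ.coe_toReal hft.1).symm
  have h3 := hab (w t)
  rw [h2, EReal.coe_le_coe_iff] at h3
  simp only [Pi.add_apply, ht]
  rw [excess_of_eq_coe h2, ENNReal.toReal_ofReal (by linarith)]
  ring

theorem excessIntegral_ae_eq (hφ : IsConvexProperLsc φ) {a : H} {b : ℝ} {z : L2 T H} {w : ℝ → H}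
    (hw : z =ᵐ[timeMeasure T] w) (h : MemL1 T (fun t => φ (w t))) :
    excessIntegral φ a b z
      = ∫⁻ t, ENNReal.ofReal ((φ (w t)).toReal - (inner ℝ a (z t) + b)) ∂(timeMeasure T) := by
  refine lintegral_congr_ae ?_
  filter_upwards [hw, h.1] with t ht hft
  rw [ht, excess_of_eq_coe (hφ.coe_toReal hft.1).symm]

theorem integrable_excess (a : H) (b : ℝ) {z : L2 T H} {w : ℝ → H}
    (h : MemL1 T (fun t => φ (w t))) :
    Integrable (fun t => (φ (w t)).toReal - (inner ℝ a (z t) + b)) (timeMeasure T) :=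
  h.2.sub (integrable_affine a b z)

theorem excessIntegral_ne_top_of_memL1 (hφ : IsConvexProperLsc φ) (a : H) (b : ℝ)
    {z : L2 T H} {w : ℝ → H} (hw : z =ᵐ[timeMeasure T] w) (h : MemL1 T (fun t => φ (w t))) :
    excessIntegral φ a b z ≠ ⊤ := by
  rw [excessIntegral_ae_eq hφ hw h]
  exact (Integrable.lintegral_lt_top (integrable_excess a b h)).ne

theorem integral_eq_excessIntegral [CompleteSpace H] (hT : 0 ≤ T) (hφ : IsConvexProperLsc φ)
    {a : H} {b : ℝ} (hab : ∀ x, ((inner ℝ a x + b : ℝ) : EReal) ≤ φ x) {z : L2 T H} {w : ℝ → H}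
    (hw : z =ᵐ[timeMeasure T] w) (h : MemL1 T (fun t => φ (w t))) :
    ∫ t, (φ (w t)).toReal ∂(timeMeasure T)
      = (excessIntegral φ a b z).toReal + (inner ℝ a (evalPrim T z) + T * b) := by
  have h1 : 0 ≤ᵐ[timeMeasure T] fun t => (φ (w t)).toReal - (inner ℝ a (z t) + b) := by
    filter_upwards [hw, h.1] with t ht hft
    have h3 := hab (w t)
    rw [(hφ.coe_toReal hft.1).symm, EReal.coe_le_coe_iff] at h3
    rw [ht]
    simpa using h3
  rw [excessIntegral_ae_eq hφ hw h, ← integral_eq_lintegral_of_nonneg_ae h1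
    (integrable_excess a b h).aestronglyMeasurable, ← integral_affine hT,
    ← integral_add (integrable_excess a b h) (integrable_affine a b z)]
  simp only [sub_add_cancel]

end IntegralFunctional

/-! ### The Brezis–Ekeland–Nayroles functional: sign, zeros, lower semicontinuity. -/

section Functional

variable {T : ℝ} {H : Type*} [NormedAddCommGroup H] [InnerProductSpace ℝ H] {φ : H → EReal}

theorem inner_le_toReal_add_toReal (hφ : IsConvexProperLsc φ) {x ξ : H} (hx : φ x ≠ ⊤)
    (hξ : conjugate φ ξ ≠ ⊤) : inner ℝ ξ x ≤ (φ x).toReal + (conjugate φ ξ).toReal := by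
  have h := le_conjugate (hφ.coe_toReal hx).symm ξ
  have hbot : conjugate φ ξ ≠ ⊥ := fun h' => by
    rw [h', le_bot_iff] at h
    exact EReal.coe_ne_bot _ h
  rw [← EReal.coe_toReal hξ hbot, EReal.coe_le_coe_iff] at h
  linarith

/-- The point `y₀ ∈ D(φ)` supplies the affine minorant of `φ*` used throughout. -/
theorem conjugate_affine_le {y₀ : H} (hφ : IsConvexProperLsc φ) (hy₀ : φ y₀ < ⊤) (ξ : H) :
    ((inner ℝ y₀ ξ + -(φ y₀).toReal : ℝ) : EReal) ≤ conjugate φ ξ := by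
  rw [real_inner_comm, ← sub_eq_add_neg]
  exact le_conjugate (hφ.coe_toReal hy₀.ne).symm ξ

/-- The Fenchel gap `φ(y) + φ*(u - y') - (u - y', y)` along a trajectory. -/
def fenchelGap (φ : H → EReal) (u : L2 T H) (y : H1 T H) (t : ℝ) : ℝ :=
  (φ (rep y t)).toReal + (conjugate φ (u t - timeDeriv y t)).toReal
    - inner ℝ (u t - timeDeriv y t) (rep y t)

theorem integrable_inner_L2 (u v : L2 T H) :
    Integrable (fun t => (inner ℝ (u t) (v t) : ℝ)) (timeMeasure T) :=
  L2.integrable_inner u v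

theorem integrable_inner_rep [CompleteSpace H] (hT : 0 < T) (u : L2 T H) (y : H1 T H) :
    Integrable (fun t => (inner ℝ (u t) (rep y t) : ℝ)) (timeMeasure T) := by
  refine (integrable_inner_L2 u y.1.fst).congr ?_
  filter_upwards [(rep_spec hT y).2] with t ht
  rw [ht]

theorem integral_inner_rep [CompleteSpace H] (hT : 0 < T) (u : L2 T H) (y : H1 T H) :
    ∫ t, (inner ℝ (u t) (rep y t) : ℝ) ∂(timeMeasure T) = inner ℝ u (toL2 y) := by
  rw [L2.inner_def]
  refine integral_congr_ae ?_
  filter_upwards [(rep_spec hT y).2] with t ht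
  rw [toL2_apply, ht]

/-- On its domain the functional is the integral of the Fenchel gap. -/
theorem benFunctional_eq_integral_fenchelGap [CompleteSpace H] (hT : 0 < T)
    {y₀ : H} (p : ControlState T H) (h0 : rep p.state 0 = y₀)
    (h1 : MemL1 T (fun t => φ (rep p.state t)))
    (h2 : MemL1 T (fun t => conjugate φ (p.control t - timeDeriv p.state t))) :
    Integrable (fenchelGap φ p.control p.state) (timeMeasure T) ∧
      benFunctional φ y₀ p
        = ((∫ t, fenchelGap φ p.control p.state t ∂(timeMeasure T) : ℝ) : EReal) := by
  have hi1 := integrable_inner_rep hT p.control p.state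
  have hi2 := integrable_inner_rep hT (timeDeriv p.state) p.state
  have hsum : Integrable (fun t => (φ (rep p.state t)).toReal
      + (conjugate φ (p.control t - timeDeriv p.state t)).toReal
      - inner ℝ (p.control t) (rep p.state t)) (timeMeasure T) := (h1.2.add h2.2).sub hi1
  -- The gap exceeds the integrand of `G` by `(y', y)`, whose integral is the boundary term of `G`.
  have hgap : fenchelGap φ p.control p.state = fun t =>
      ((φ (rep p.state t)).toReal + (conjugate φ (p.control t - timeDeriv p.state t)).toReal
        - inner ℝ (p.control t) (rep p.state t))
        + inner ℝ (timeDeriv p.state t) (rep p.state t) := by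
    ext t
    rw [fenchelGap, inner_sub_left]; ring
  refine ⟨by rw [hgap]; exact hsum.add hi2, ?_⟩
  simp only [benFunctional]
  rw [if_pos ⟨h0, h1, h2⟩, hgap, integral_add hsum hi2, integral_inner_rep hT,
    inner_timeDeriv_self hT, ← rep_eq_evalAt hT _ (left_mem_Icc.2 hT.le),
    ← rep_eq_evalAt hT _ (right_mem_Icc.2 hT.le), h0, add_sub_assoc]

theorem fenchelGap_nonneg (hφ : IsConvexProperLsc φ) (p : ControlState T H)
    (h1 : MemL1 T (fun t => φ (rep p.state t)))
    (h2 : MemL1 T (fun t => conjugate φ (p.control t - timeDeriv p.state t))) :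
    0 ≤ᵐ[timeMeasure T] fenchelGap φ p.control p.state := by
  filter_upwards [h1.1, h2.1] with t ht1 ht2
  exact sub_nonneg.2 (inner_le_toReal_add_toReal hφ ht1.1 ht2.1)

theorem benFunctional_nonneg [CompleteSpace H] (hT : 0 < T) (hφ : IsConvexProperLsc φ) (y₀ : H)
    (p : ControlState T H) : 0 ≤ benFunctional φ y₀ p := by
  by_cases h : rep p.state 0 = y₀ ∧ MemL1 T (fun t => φ (rep p.state t)) ∧
      MemL1 T (fun t => conjugate φ (p.control t - timeDeriv p.state t))
  · rw [(benFunctional_eq_integral_fenchelGap hT p h.1 h.2.1 h.2.2).2]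
    exact_mod_cast integral_nonneg_of_ae (fenchelGap_nonneg hφ p h.2.1 h.2.2)
  · simp only [benFunctional]
    rw [if_neg h]
    exact le_top

/-- The zeros of the functional solve the gradient flow. -/
theorem isGradientFlow_of_benFunctional_eq_zero [CompleteSpace H] (hT : 0 < T)
    (hφ : IsConvexProperLsc φ) {y₀ : H} {p : ControlState T H} (h : benFunctional φ y₀ p = 0) :
    IsGradientFlow φ y₀ p.control p.state := by
  by_cases hdom : rep p.state 0 = y₀ ∧ MemL1 T (fun t => φ (rep p.state t)) ∧
      MemL1 T (fun t => conjugate φ (p.control t - timeDeriv p.state t))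
  · obtain ⟨h0, h1, h2⟩ := hdom
    obtain ⟨hint, heq⟩ := benFunctional_eq_integral_fenchelGap hT p h0 h1 h2
    rw [heq] at h
    have hz := (integral_eq_zero_iff_of_nonneg_ae (fenchelGap_nonneg hφ p h1 h2) hint).1
      (by exact_mod_cast h)
    refine ⟨h0, ?_⟩
    filter_upwards [hz, h1.1, h2.1] with t ht ht1 ht2
    exact mem_subdifferential_of_fenchel_eq hφ ht1.1 (EReal.coe_toReal ht2.1 ht2.2).symm
      (sub_eq_zero.1 ht)
  · simp only [benFunctional] at h
    rw [if_neg hdom] at h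
    simp at h

/-- The weakly lower semicontinuous part of the functional, as a function of `y`, `u - y'`
and `y(T)`. -/
def weakEnergy (φ : H → EReal) (a : H) (b : ℝ) (y₀ : H)
    (q : WeakSpace ℝ (L2 T H) × WeakSpace ℝ (L2 T H) × WeakSpace ℝ H) : ℝ≥0∞ :=
  excessIntegral φ a b ((toWeakSpace ℝ (L2 T H)).symm q.1)
    + excessIntegral (conjugate φ) y₀ (-(φ y₀).toReal) ((toWeakSpace ℝ (L2 T H)).symm q.2.1)
    + ENNReal.ofReal (1 / 2 * ‖(toWeakSpace ℝ H).symm q.2.2‖ ^ 2)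

/-- The finite sublevels are closed balls, which are convex and hence weakly closed. -/
theorem lowerSemicontinuous_weak_norm_sq :
    LowerSemicontinuous fun x : WeakSpace ℝ H =>
      ENNReal.ofReal (1 / 2 * ‖(toWeakSpace ℝ H).symm x‖ ^ 2) := by
  refine lowerSemicontinuous_iff_isClosed_preimage.2 fun c => ?_
  by_cases hc : c = ⊤
  · simp [hc]
  have h : {x : H | ENNReal.ofReal (1 / 2 * ‖x‖ ^ 2) ≤ c} = Metric.closedBall 0 √(2 * c.toReal) := by
    ext x
    rw [mem_ofPred_eq, mem_closedBall_zero_iff, Real.le_sqrt (norm_nonneg _) (by positivity),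
      ENNReal.ofReal_le_iff_le_toReal hc]
    constructor <;> intro h <;> linarith
  exact isClosed_weak_of_convex (s := {x : H | ENNReal.ofReal (1 / 2 * ‖x‖ ^ 2) ≤ c})
    (h ▸ Metric.isClosed_closedBall) (h ▸ convex_closedBall _ _)

theorem lowerSemicontinuous_weakEnergy [CompleteSpace H] (hφ : IsConvexProperLsc φ) {a : H} {b : ℝ}
    (hab : ∀ x, ((inner ℝ a x + b : ℝ) : EReal) ≤ φ x) {y₀ : H} (hy₀ : φ y₀ < ⊤) :
    LowerSemicontinuous (weakEnergy (T := T) φ a b y₀) :=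
  (((lowerSemicontinuous_weak_excessIntegral hφ hab).comp continuous_fst).add
    ((lowerSemicontinuous_weak_excessIntegral hφ.conjugate (conjugate_affine_le hφ hy₀)).comp
      (continuous_fst.comp continuous_snd))).add
    (lowerSemicontinuous_weak_norm_sq.comp (continuous_snd.comp continuous_snd))

/-- The variables of `weakEnergy` as functions of control and state. -/
def weakVariables (p : ControlState T H) :
    WeakSpace ℝ (L2 T H) × WeakSpace ℝ (L2 T H) × WeakSpace ℝ H :=
  (toWeakSpace ℝ (L2 T H) (toL2 p.state),
    toWeakSpace ℝ (L2 T H) (p.control - timeDeriv p.state),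
    toWeakSpace ℝ H (evalAt T p.state))

theorem continuous_weakVariables : Continuous (weakVariables (T := T) (H := H)) := by
  refine Continuous.prodMk ?_ (Continuous.prodMk ?_ ?_)
  · exact (WeakSpace.map (toL2 (T := T) (H := H))).continuous.comp continuous_snd
  · exact ((toWeakSpaceCLM ℝ (L2 T H)).continuous.comp continuous_fst).sub
      ((WeakSpace.map (derivL (T := T) (H := H))).continuous.comp continuous_snd)
  · exact (WeakSpace.map (evalAt (T := T) (H := H) T)).continuous.comp continuous_snd

/-- The lower order part of the functional. -/
def lowerOrder (φ : H → EReal) (a : H) (b : ℝ) (y₀ : H) (p : ControlState T H) : ℝ :=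
  (inner ℝ a (evalPrim T (toL2 p.state)) + T * b)
    + (inner ℝ y₀ (evalPrim T (p.control - timeDeriv p.state)) + T * -(φ y₀).toReal)
    - inner ℝ p.control (toL2 p.state) - 1 / 2 * ‖y₀‖ ^ 2

/-- Split `(u, y) = (u₀, y) + (u - u₀, y)`: the first term is weakly continuous in `y`, the second
is at most a constant times `‖u - u₀‖ R`. The bound on the states is what confines the result to
`K`. -/
theorem continuousOn_inner_control_state {K : Set (ControlState T H)} {R : ℝ}
    (hR : ∀ p ∈ K, ‖p.state‖ ≤ R) :
    ContinuousOn (fun p : ControlState T H => (inner ℝ p.control (toL2 p.state) : ℝ)) K := by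
  intro p₀ _
  have hu : Tendsto (fun p : ControlState T H => p.control) (𝓝[K] p₀) (𝓝 p₀.control) :=
    (continuous_fst.tendsto p₀).mono_left nhdsWithin_le_nhds
  have h1 : Tendsto (fun p : ControlState T H => (inner ℝ p₀.control (toL2 p.state) : ℝ))
      (𝓝[K] p₀) (𝓝 (inner ℝ p₀.control (toL2 p₀.state))) :=
    (((continuous_weak_eval ((innerSL ℝ p₀.control).comp toL2)).comp
      continuous_snd).tendsto p₀).mono_left nhdsWithin_le_nhds
  have h2 : Tendsto (fun p : ControlState T H =>
      (inner ℝ (p.control - p₀.control) (toL2 p.state) : ℝ)) (𝓝[K] p₀) (𝓝 0) := by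
    have h3 : Tendsto (fun p : ControlState T H => ‖p.control - p₀.control‖ * (‖toL2 (T := T) (H := H)‖ * R))
        (𝓝[K] p₀) (𝓝 0) := by
      have := ((hu.sub_const p₀.control).norm).mul_const (‖toL2 (T := T) (H := H)‖ * R)
      simpa using this
    refine squeeze_zero_norm' ?_ h3
    filter_upwards [self_mem_nhdsWithin] with p hp
    refine (norm_inner_le_norm _ _).trans ?_
    gcongr
    exact toL2.le_opNorm_of_le (hR p hp)
  have h4 := h1.add h2
  rw [add_zero] at h4
  refine h4.congr fun p => ?_
  rw [inner_sub_left]; ring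

theorem continuousOn_lowerOrder (φ : H → EReal) (a : H) (b : ℝ) (y₀ : H)
    {K : Set (ControlState T H)} {R : ℝ} (hR : ∀ p ∈ K, ‖p.state‖ ≤ R) :
    ContinuousOn (lowerOrder φ a b y₀) K := by
  have h1 : Continuous fun p : ControlState T H => (inner ℝ a (evalPrim T (toL2 p.state)) : ℝ) :=
    (continuous_weak_eval ((innerSL ℝ a).comp ((evalPrim T).comp toL2))).comp continuous_snd
  have h2 : Continuous fun p : ControlState T H =>
      (inner ℝ y₀ (evalPrim T (p.control - timeDeriv p.state)) : ℝ) := by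
    have h3 : Continuous fun p : ControlState T H => (inner ℝ y₀ (evalPrim T p.control) : ℝ) :=
      ((innerSL ℝ y₀).comp (evalPrim T)).continuous.comp continuous_fst
    have h4 : Continuous fun p : ControlState T H =>
        (inner ℝ y₀ (evalPrim T (timeDeriv p.state)) : ℝ) :=
      (continuous_weak_eval ((innerSL ℝ y₀).comp ((evalPrim T).comp derivL))).comp continuous_snd
    refine (h3.sub h4).congr fun p => ?_
    rw [map_sub, inner_sub_right, Pi.sub_apply]
  exact (((h1.add continuous_const).add (h2.add continuous_const)).continuousOn.sub
    (continuousOn_inner_control_state hR)).sub continuousOn_const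

theorem coeFn_control_sub (u : L2 T H) (y : H1 T H) :
    (u - timeDeriv y : L2 T H) =ᵐ[timeMeasure T] fun t => u t - timeDeriv y t :=
  Lp.coeFn_sub u (timeDeriv y)

-- Separates a weakly lower semicontinuous part with values in `[0,∞]` from a finite part that is
-- continuous on bounded sets, so that the sum in `EReal` is harmless.
open Classical in
theorem benFunctional_eq [CompleteSpace H] (hT : 0 < T) (hφ : IsConvexProperLsc φ) {a : H} {b : ℝ}
    (hab : ∀ x, ((inner ℝ a x + b : ℝ) : EReal) ≤ φ x) {y₀ : H} (hy₀ : φ y₀ < ⊤)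
    (p : ControlState T H) :
    benFunctional φ y₀ p = if evalAt 0 p.state = y₀ then
      (weakEnergy φ a b y₀ (weakVariables p) : EReal) + (lowerOrder φ a b y₀ p : ℝ) else ⊤ := by
  have hc := hφ.conjugate
  have hab' := conjugate_affine_le hφ hy₀
  have hrep := (rep_spec hT p.state).2
  have hsub := coeFn_control_sub p.control p.state
  have h00 : rep p.state 0 = evalAt 0 p.state := rep_eq_evalAt hT _ (left_mem_Icc.2 hT.le)
  by_cases h0 : evalAt 0 p.state = y₀
  swap
  · simp [benFunctional, h00, h0]
  rw [if_pos h0]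
  by_cases htop : weakEnergy φ a b y₀ (weakVariables p) = ⊤
  · rw [htop, EReal.coe_ennreal_top, EReal.top_add_coe]
    simp only [benFunctional]
    rw [if_neg]
    rintro ⟨-, h1, h2⟩
    have h3 := excessIntegral_ne_top_of_memL1 hφ a b hrep h1
    have h4 := excessIntegral_ne_top_of_memL1 hc y₀ (-(φ y₀).toReal) hsub h2
    exact ENNReal.add_ne_top.2 ⟨ENNReal.add_ne_top.2 ⟨h3, h4⟩, ENNReal.ofReal_ne_top⟩ htop
  · obtain ⟨hs, h5⟩ := ENNReal.add_ne_top.1 htop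
    obtain ⟨h3, h4⟩ := ENNReal.add_ne_top.1 hs
    have h1 := memL1_of_excessIntegral_ne_top hφ hab hrep h3
    have h2 := memL1_of_excessIntegral_ne_top hc hab' hsub h4
    have hi1 := integrable_inner_rep hT p.control p.state
    have hsum : Integrable (fun t => (φ (rep p.state t)).toReal
      + (conjugate φ (p.control t - timeDeriv p.state t)).toReal) (timeMeasure T) := h1.2.add h2.2
    have hE : (weakEnergy φ a b y₀ (weakVariables p) : EReal)
        = ((weakEnergy φ a b y₀ (weakVariables p)).toReal : EReal) :=
      (EReal.coe_ennreal_toReal htop).symm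
    have hE' : (weakEnergy φ a b y₀ (weakVariables p)).toReal
        = (excessIntegral φ a b (toL2 p.state)).toReal
          + (excessIntegral (conjugate φ) y₀ (-(φ y₀).toReal)
              (p.control - timeDeriv p.state)).toReal
          + 1 / 2 * ‖evalAt T p.state‖ ^ 2 := by
      rw [weakEnergy, ENNReal.toReal_add hs h5, ENNReal.toReal_add h3 h4,
        ENNReal.toReal_ofReal (by positivity)]
      rfl
    rw [hE, ← EReal.coe_add, hE', lowerOrder]
    simp only [benFunctional]
    rw [if_pos ⟨h00.trans h0, h1, h2⟩, integral_sub hsum hi1, integral_add h1.2 h2.2,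
      integral_eq_excessIntegral hT.le hφ hab hrep h1,
      integral_eq_excessIntegral hT.le hc hab' hsub h2, integral_inner_rep hT,
      rep_eq_evalAt hT _ (right_mem_Icc.2 hT.le)]
    congr 1
    rw [← toL2_apply]
    ring

theorem lowerSemicontinuousOn_benFunctional [CompleteSpace H] (hT : 0 < T)
    (hφ : IsConvexProperLsc φ) {y₀ : H} (hy₀ : φ y₀ < ⊤) {K : Set (ControlState T H)}
    (hK : IsCompact K) : LowerSemicontinuousOn (benFunctional φ y₀) K := by
  classical
  obtain ⟨a, b, hab⟩ := hφ.exists_affine_le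
  obtain ⟨R, hR⟩ := exists_norm_state_le hK
  intro p₀ hp₀ c hc
  rw [benFunctional_eq hT hφ hab hy₀] at hc
  by_cases h0 : evalAt 0 p₀.state = y₀
  · rw [if_pos h0] at hc
    have h1 : LowerSemicontinuousWithinAt (fun p : ControlState T H =>
        (weakEnergy φ a b y₀ (weakVariables p) : EReal)) K p₀ :=
      (continuous_coe_ennreal_ereal.comp_lowerSemicontinuous
        ((lowerSemicontinuous_weakEnergy hφ hab hy₀).comp continuous_weakVariables)
        fun x y h => EReal.coe_ennreal_le_coe_ennreal_iff.2 h).lowerSemicontinuousWithinAt K p₀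
    have h2 : LowerSemicontinuousWithinAt (fun p : ControlState T H =>
        ((lowerOrder φ a b y₀ p : ℝ) : EReal)) K p₀ :=
      (continuous_coe_real_ereal.continuousAt.comp_continuousWithinAt
        (continuousOn_lowerOrder φ a b y₀ hR p₀ hp₀)).lowerSemicontinuousWithinAt
    have h3 := h1.add' h2
      (EReal.continuousAt_add (Or.inr (EReal.coe_ne_bot _)) (Or.inr (EReal.coe_ne_top _)))
    filter_upwards [h3 c hc] with p hp
    rw [benFunctional_eq hT hφ hab hy₀]
    split_ifs
    · exact hp
    · exact hp.trans_le le_top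
  · rw [if_neg h0] at hc
    -- Evaluation at `0` is weakly continuous and the weak topology is Hausdorff, so a violated
    -- initial condition stays violated nearby, where the functional is `⊤`.
    have hopen : IsOpen {p : ControlState T H | evalAt 0 p.state ≠ y₀} := by
      have hcont : Continuous fun p : ControlState T H =>
          toWeakSpace ℝ H (evalAt 0 p.state) :=
        (WeakSpace.map (evalAt (T := T) (H := H) 0)).continuous.comp continuous_snd
      exact (isOpen_ne (x := toWeakSpace ℝ H y₀)).preimage hcont
    filter_upwards [mem_nhdsWithin_of_mem_nhds (hopen.mem_nhds h0)] with p hp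
    rw [benFunctional_eq hT hφ hab hy₀, if_neg hp]
    exact hc

end Functional

/-! ### Resolvent, Yosida approximation and Moreau envelope. -/

section Yosida

theorem IsConvexProperLsc.le_of_tendsto {H : Type*} [NormedAddCommGroup H]
    [InnerProductSpace ℝ H] {φ : H → EReal} (hφ : IsConvexProperLsc φ) {x : ℕ → H} {x₀ : H}
    {c : ℕ → ℝ} {c₀ : ℝ} (hx : Tendsto x atTop (𝓝 x₀)) (hc : Tendsto c atTop (𝓝 c₀))
    (h : ∀ n, φ (x n) ≤ c n) : φ x₀ ≤ c₀ :=
  hφ.lsc.isClosed_epigraph.mem_of_tendsto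
    (hx.prodMk_nhds ((continuous_coe_real_ereal.tendsto c₀).comp hc)) (Eventually.of_forall h)

/-- Expand `‖(x - y) + r a‖² ≥ 0`. It bounds the proximal problem and the Moreau envelope from
below. -/
theorem affine_le_quadratic {H : Type*} [NormedAddCommGroup H] [InnerProductSpace ℝ H]
    {r : ℝ} (hr : 0 < r) (a x y : H) :
    inner ℝ a y - r / 2 * ‖a‖ ^ 2 ≤ inner ℝ a x + 1 / (2 * r) * ‖x - y‖ ^ 2 := by
  have h : 0 ≤ 1 / (2 * r) * ‖(x - y) + r • a‖ ^ 2 := by positivity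
  rw [norm_add_sq_real, real_inner_smul_right, norm_smul, Real.norm_of_nonneg hr.le,
    inner_sub_left, real_inner_comm, real_inner_comm a y] at h
  have h2 : 1 / (2 * r) * (‖x - y‖ ^ 2 + 2 * (r * (inner ℝ a x - inner ℝ a y)) + (r * ‖a‖) ^ 2)
      = 1 / (2 * r) * ‖x - y‖ ^ 2 + (inner ℝ a x - inner ℝ a y) + r / 2 * ‖a‖ ^ 2 := by
    field_simp
  rw [h2] at h
  linarith

variable {H : Type*} [NormedAddCommGroup H] [InnerProductSpace ℝ H] [CompleteSpace H]
  {φ : H → EReal}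

/-- The proximal problem has a solution. -/
theorem IsConvexProperLsc.exists_prox_minimizer (hφ : IsConvexProperLsc φ) {r : ℝ} (hr : 0 < r)
    (y : H) : ∃ x, φ x ≠ ⊤ ∧ ∀ z, φ z ≠ ⊤ →
      (φ x).toReal + 1 / (2 * r) * ‖x - y‖ ^ 2 ≤ (φ z).toReal + 1 / (2 * r) * ‖z - y‖ ^ 2 := by
  obtain ⟨a, b, hab⟩ := hφ.exists_affine_le
  let q : H → ℝ := fun x => (φ x).toReal + 1 / (2 * r) * ‖x - y‖ ^ 2
  let S : Set ℝ := q '' {x | φ x ≠ ⊤}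
  have hne : S.Nonempty := by
    obtain ⟨x, hx⟩ := hφ.proper
    exact ⟨_, mem_image_of_mem q hx⟩
  have hbdd : BddBelow S := by
    refine ⟨inner ℝ a y - r / 2 * ‖a‖ ^ 2 + b, ?_⟩
    rintro _ ⟨x, hx, rfl⟩
    have h1 := hab x
    rw [← hφ.coe_toReal hx, EReal.coe_le_coe_iff] at h1
    have h2 := affine_le_quadratic hr a x y
    simp only [q]
    linarith
  have hm : ∀ x, φ x ≠ ⊤ → sInf S ≤ q x := fun x hx => csInf_le hbdd (mem_image_of_mem q hx)
  have hex : ∀ n : ℕ, ∃ x, φ x ≠ ⊤ ∧ q x < sInf S + 1 / ((n : ℝ) + 1) := fun n => by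
    obtain ⟨_, ⟨x, hx, rfl⟩, hlt⟩ := exists_lt_of_csInf_lt hne
      (lt_add_of_pos_right (sInf S) (Nat.one_div_pos_of_nat (α := ℝ) (n := n)))
    exact ⟨x, hx, hlt⟩
  choose x hxD hxq using hex
  -- The midpoint is a competitor, and the parallelogram identity turns its near-optimality into a
  -- Cauchy estimate for the minimizing sequence.
  have hdist : ∀ n k : ℕ, ‖x n - x k‖ ^ 2 ≤ 4 * r * (1 / ((n : ℝ) + 1) + 1 / ((k : ℝ) + 1)) := by
    intro n k
    have h1 := hφ.le_combo (hφ.coe_toReal (hxD n)).ge (hφ.coe_toReal (hxD k)).ge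
      (s := 1 / 2) (t := 1 / 2) (by norm_num) (by norm_num) (by norm_num)
    set w := (1 / 2 : ℝ) • x n + (1 / 2 : ℝ) • x k with hw
    have hwD : φ w ≠ ⊤ := ne_top_of_le_ne_top (EReal.coe_ne_top _) h1
    have h2 := hm w hwD
    rw [← hφ.coe_toReal hwD, EReal.coe_le_coe_iff] at h1
    have h3 : ‖w - y‖ ^ 2 = 1 / 2 * ‖x n - y‖ ^ 2 + 1 / 2 * ‖x k - y‖ ^ 2
        - 1 / 4 * ‖x n - x k‖ ^ 2 := by
      have e1 : w - y = (1 / 2 : ℝ) • ((x n - y) + (x k - y)) := by rw [hw]; module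
      have e2 : x n - x k = (x n - y) - (x k - y) := by abel
      rw [e1, e2]
      generalize x n - y = p
      generalize x k - y = q
      rw [norm_smul, mul_pow, norm_add_sq_real, norm_sub_sq_real, Real.norm_of_nonneg (by norm_num)]
      ring
    have h4 := hxq n
    have h5 := hxq k
    simp only [q] at h2 h4 h5
    rw [h3] at h2
    have h6 : 1 / (2 * r) * (1 / 4 * ‖x n - x k‖ ^ 2)
        ≤ 1 / 2 * (1 / ((n : ℝ) + 1) + 1 / ((k : ℝ) + 1)) := by nlinarith
    have h7 : ‖x n - x k‖ ^ 2 = 8 * r * (1 / (2 * r) * (1 / 4 * ‖x n - x k‖ ^ 2)) := by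
      field_simp; ring
    rw [h7]
    calc _ ≤ 8 * r * (1 / 2 * (1 / ((n : ℝ) + 1) + 1 / ((k : ℝ) + 1))) := by gcongr
      _ = _ := by ring
  have hcau : CauchySeq x := by
    refine cauchySeq_of_le_tendsto_0 (fun N : ℕ => √(8 * r * (1 / ((N : ℝ) + 1))))
      (fun n k N hn hk => ?_) ?_
    · rw [dist_eq_norm]
      refine Real.le_sqrt_of_sq_le ((hdist n k).trans ?_)
      have h1 : 1 / ((n : ℝ) + 1) ≤ 1 / ((N : ℝ) + 1) := Nat.one_div_le_one_div hn
      have h2 : 1 / ((k : ℝ) + 1) ≤ 1 / ((N : ℝ) + 1) := Nat.one_div_le_one_div hk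
      nlinarith
    · have := ((tendsto_one_div_add_atTop_nhds_zero_nat (𝕜 := ℝ)).const_mul (8 * r)).sqrt
      simpa using this
  obtain ⟨x₀, hx₀⟩ := cauchySeq_tendsto_of_complete hcau
  have hle : φ x₀ ≤ ((sInf S + 0 - 1 / (2 * r) * ‖x₀ - y‖ ^ 2 : ℝ) : EReal) := by
    refine hφ.le_of_tendsto (c := fun n => sInf S + 1 / ((n : ℝ) + 1)
      - 1 / (2 * r) * ‖x n - y‖ ^ 2) hx₀ ?_ fun n => ?_
    · exact (tendsto_const_nhds.add tendsto_one_div_add_atTop_nhds_zero_nat).sub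
        (((hx₀.sub_const y).norm.pow 2).const_mul _)
    · rw [← hφ.coe_toReal (hxD n), EReal.coe_le_coe_iff]
      have := hxq n
      simp only [q] at this
      linarith
  have hD : φ x₀ ≠ ⊤ := ne_top_of_le_ne_top (EReal.coe_ne_top _) hle
  refine ⟨x₀, hD, fun z hz => ?_⟩
  rw [← hφ.coe_toReal hD, EReal.coe_le_coe_iff] at hle
  have := hm z hz
  simp only [q] at this
  linarith

/-- Euler–Lagrange inequality: compare the proximal minimizer with `(1 - t) x + t z`, divide by `t`
and let `t → 0`. -/
theorem IsConvexProperLsc.exists_resolvent (hφ : IsConvexProperLsc φ) {r : ℝ} (hr : 0 < r)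
    (y : H) : ∃ x, r⁻¹ • (y - x) ∈ subdifferential φ x := by
  obtain ⟨x, hx, hmin⟩ := hφ.exists_prox_minimizer hr y
  refine ⟨x, (mem_subdifferential_iff hφ).2 ⟨hx, fun z => ?_⟩⟩
  by_cases hz : φ z = ⊤
  · rw [hz]; exact le_top
  rw [← hφ.coe_toReal hz, EReal.coe_le_coe_iff]
  set B := 1 / (2 * r) * ‖z - x‖ ^ 2 with hB
  have key : ∀ t : ℝ, 0 < t → t < 1 →
      0 ≤ ((φ z).toReal - ((φ x).toReal + inner ℝ (r⁻¹ • (y - x)) (z - x))) + t * B := by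
    intro t ht ht1
    have h1 := hφ.le_combo (hφ.coe_toReal hx).ge (hφ.coe_toReal hz).ge
      (s := 1 - t) (t := t) (by linarith) ht.le (by ring)
    set w := (1 - t) • x + t • z with hw
    have hwD : φ w ≠ ⊤ := ne_top_of_le_ne_top (EReal.coe_ne_top _) h1
    have h2 := hmin w hwD
    rw [← hφ.coe_toReal hwD, EReal.coe_le_coe_iff] at h1
    have h3 : ‖w - y‖ ^ 2 = ‖x - y‖ ^ 2 - 2 * t * inner ℝ (y - x) (z - x)
        + t ^ 2 * ‖z - x‖ ^ 2 := by
      have e1 : w - y = (x - y) + t • (z - x) := by rw [hw]; module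
      rw [e1, norm_add_sq_real, real_inner_smul_right, norm_smul, mul_pow, Real.norm_eq_abs, sq_abs,
        ← neg_sub y x, inner_neg_left]
      ring
    rw [h3] at h2
    have h4 : 0 ≤ t * (((φ z).toReal - ((φ x).toReal + inner ℝ (r⁻¹ • (y - x)) (z - x)))
        + t * B) := by
      rw [real_inner_smul_left, hB]
      have e2 : 1 / (2 * r) * (‖x - y‖ ^ 2 - 2 * t * inner ℝ (y - x) (z - x)
          + t ^ 2 * ‖z - x‖ ^ 2) = 1 / (2 * r) * ‖x - y‖ ^ 2
            - t * (r⁻¹ * inner ℝ (y - x) (z - x)) + t * (t * (1 / (2 * r) * ‖z - x‖ ^ 2)) := by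
        field_simp
      rw [e2] at h2
      linarith
    exact nonneg_of_mul_nonneg_right h4 ht
  have hlim : Tendsto (fun t : ℝ =>
      ((φ z).toReal - ((φ x).toReal + inner ℝ (r⁻¹ • (y - x)) (z - x))) + t * B) (𝓝[>] 0)
      (𝓝 (((φ z).toReal - ((φ x).toReal + inner ℝ (r⁻¹ • (y - x)) (z - x))) + 0 * B)) :=
    Tendsto.mono_left (Continuous.tendsto (by fun_prop) 0) nhdsWithin_le_nhds
  have h0 := ge_of_tendsto hlim (by
    filter_upwards [Ioo_mem_nhdsGT (zero_lt_one (α := ℝ))] with t ht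
    exact key t ht.1 ht.2)
  linarith

/-- The resolvent `(1 + r ∂φ)⁻¹`. -/
def resolvent (hφ : IsConvexProperLsc φ) {r : ℝ} (hr : 0 < r) (y : H) : H :=
  (hφ.exists_resolvent hr y).choose

/-- The Yosida approximation of `∂φ`. -/
def yosida (hφ : IsConvexProperLsc φ) {r : ℝ} (hr : 0 < r) (y : H) : H :=
  r⁻¹ • (y - resolvent hφ hr y)

/-- The Moreau envelope of `φ`. -/
def moreau (hφ : IsConvexProperLsc φ) {r : ℝ} (hr : 0 < r) (y : H) : ℝ :=
  (φ (resolvent hφ hr y)).toReal + r / 2 * ‖yosida hφ hr y‖ ^ 2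

variable (hφ : IsConvexProperLsc φ) {r : ℝ} (hr : 0 < r)

theorem yosida_mem_subdifferential (y : H) :
    yosida hφ hr y ∈ subdifferential φ (resolvent hφ hr y) :=
  (hφ.exists_resolvent hr y).choose_spec

theorem resolvent_eq (y : H) : resolvent hφ hr y = y - r • yosida hφ hr y := by
  simp [yosida, smul_smul, hr.ne']

theorem subgradient_ineq (y z : H) :
    (φ (resolvent hφ hr y)).toReal
        + inner ℝ (yosida hφ hr y) (resolvent hφ hr z - resolvent hφ hr y)
      ≤ (φ (resolvent hφ hr z)).toReal := by
  have hz := ((mem_subdifferential_iff hφ).1 (yosida_mem_subdifferential hφ hr z)).1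
  have h := ((mem_subdifferential_iff hφ).1 (yosida_mem_subdifferential hφ hr y)).2
    (resolvent hφ hr z)
  rwa [← hφ.coe_toReal hz, EReal.coe_le_coe_iff] at h

/-- The subgradient inequality at the resolvents, rewritten through `y - r • yosida`. This
quantitative convexity carries both the Lipschitz bound and the differentiability of the envelope.
-/
theorem moreau_add_inner_le (y z : H) :
    moreau hφ hr y + inner ℝ (yosida hφ hr y) (z - y)
      + r / 2 * ‖yosida hφ hr z - yosida hφ hr y‖ ^ 2 ≤ moreau hφ hr z := by
  have h := subgradient_ineq hφ hr y z
  rw [moreau, moreau]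
  have h1 : resolvent hφ hr z - resolvent hφ hr y
      = (z - y) - r • (yosida hφ hr z - yosida hφ hr y) := by
    rw [resolvent_eq, resolvent_eq]; module
  rw [h1, inner_sub_right, real_inner_smul_right,
    inner_sub_right (yosida hφ hr y) (yosida hφ hr z), real_inner_self_eq_norm_sq] at h
  rw [norm_sub_sq_real, real_inner_comm (yosida hφ hr y) (yosida hφ hr z)]
  linarith

/-- Adding `moreau_add_inner_le` to itself with `y` and `z` exchanged gives cocoercivity with
constant `r`; Cauchy–Schwarz finishes. -/
theorem norm_yosida_sub_le (y z : H) :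
    ‖yosida hφ hr z - yosida hφ hr y‖ ≤ r⁻¹ * ‖z - y‖ := by
  have h1 := moreau_add_inner_le hφ hr y z
  have h2 := moreau_add_inner_le hφ hr z y
  rw [norm_sub_rev (yosida hφ hr y)] at h2
  have h3 : inner ℝ (yosida hφ hr z) (y - z) = -inner ℝ (yosida hφ hr z) (z - y) := by
    rw [← inner_neg_right, neg_sub]
  have h4 : r * ‖yosida hφ hr z - yosida hφ hr y‖ ^ 2
      ≤ inner ℝ (yosida hφ hr z - yosida hφ hr y) (z - y) := by
    rw [inner_sub_left]; linarith
  have h5 := h4.trans (real_inner_le_norm _ _)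
  rcases (norm_nonneg (yosida hφ hr z - yosida hφ hr y)).eq_or_lt with h0 | h0
  · rw [← h0]; positivity
  · rw [le_inv_mul_iff₀ hr]
    refine le_of_mul_le_mul_left ?_ h0
    linarith

theorem lipschitzWith_yosida : LipschitzWith (Real.toNNReal r⁻¹) (yosida hφ hr) :=
  LipschitzWith.of_dist_le_mul fun y z => by
    rw [dist_eq_norm, dist_eq_norm, Real.coe_toNNReal _ (inv_nonneg.2 hr.le)]
    exact norm_yosida_sub_le hφ hr z y

/-- The first-order remainder lies between `0` and `r⁻¹ ‖z - y‖²`, by the convexity inequality from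
both sides and the Lipschitz bound. -/
theorem hasFDerivAt_moreau (y : H) :
    HasFDerivAt (moreau hφ hr) (innerSL ℝ (yosida hφ hr y)) y := by
  rw [hasFDerivAt_iff_isLittleO]
  have hO : (fun z => moreau hφ hr z - moreau hφ hr y - innerSL ℝ (yosida hφ hr y) (z - y))
      =O[𝓝 y] fun z => ‖z - y‖ ^ 2 := by
    refine Asymptotics.IsBigO.of_bound r⁻¹ (Eventually.of_forall fun z => ?_)
    have h1 := moreau_add_inner_le hφ hr y z
    have h2 := moreau_add_inner_le hφ hr z y
    have h3 : inner ℝ (yosida hφ hr z) (y - z) = -inner ℝ (yosida hφ hr z) (z - y) := by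
      rw [← inner_neg_right, neg_sub]
    have h4 := real_inner_le_norm (yosida hφ hr z - yosida hφ hr y) (z - y)
    have h5 := mul_le_mul_of_nonneg_right (norm_yosida_sub_le hφ hr y z) (norm_nonneg (z - y))
    rw [inner_sub_left] at h4
    have h6 : 0 ≤ r / 2 * ‖yosida hφ hr z - yosida hφ hr y‖ ^ 2 := by positivity
    have h7 : 0 ≤ r / 2 * ‖yosida hφ hr y - yosida hφ hr z‖ ^ 2 := by positivity
    rw [innerSL_apply_apply, Real.norm_eq_abs, Real.norm_of_nonneg (by positivity), abs_le]
    constructor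
    · have : 0 ≤ r⁻¹ * ‖z - y‖ ^ 2 := by positivity
      linarith
    · nlinarith
  refine hO.trans_isLittleO ?_
  simpa using (Asymptotics.isLittleO_pow_sub_sub y (m := 2) (by norm_num))

theorem moreau_le (y : H) (hy : φ y ≠ ⊤) : moreau hφ hr y ≤ (φ y).toReal := by
  have h := ((mem_subdifferential_iff hφ).1 (yosida_mem_subdifferential hφ hr y)).2 y
  rw [← hφ.coe_toReal hy, EReal.coe_le_coe_iff, resolvent_eq hφ hr y, sub_sub_cancel,
    real_inner_smul_right, real_inner_self_eq_norm_sq, ← resolvent_eq] at h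
  rw [moreau]
  have : 0 ≤ r / 2 * ‖yosida hφ hr y‖ ^ 2 := by positivity
  linarith

/-- With `moreau_le` at the initial time, this lower bound at the final time closes the energy
estimate, uniformly for `r ≤ 1`. -/
theorem le_moreau {a : H} {b : ℝ} (hab : ∀ x, ((inner ℝ a x + b : ℝ) : EReal) ≤ φ x) (y : H) :
    inner ℝ a y + b - r / 2 * ‖a‖ ^ 2 ≤ moreau hφ hr y := by
  have h1 := hab (resolvent hφ hr y)
  rw [← hφ.coe_toReal ((mem_subdifferential_iff hφ).1 (yosida_mem_subdifferential hφ hr y)).1,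
    EReal.coe_le_coe_iff] at h1
  have h2 := affine_le_quadratic hr a (resolvent hφ hr y) y
  have h3 : ‖resolvent hφ hr y - y‖ = r * ‖yosida hφ hr y‖ := by
    rw [resolvent_eq, sub_sub_cancel_left, norm_neg, norm_smul, Real.norm_of_nonneg hr.le]
  rw [h3] at h2
  have h4 : 1 / (2 * r) * (r * ‖yosida hφ hr y‖) ^ 2 = r / 2 * ‖yosida hφ hr y‖ ^ 2 := by
    field_simp
  rw [h4] at h2
  rw [moreau]
  linarith

theorem fenchel_eq_yosida (y : H) :
    conjugate φ (yosida hφ hr y) =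
      ((inner ℝ (yosida hφ hr y) (resolvent hφ hr y) - (φ (resolvent hφ hr y)).toReal : ℝ) : EReal) :=
  conjugate_eq_of_mem_subdifferential hφ (yosida_mem_subdifferential hφ hr y)

end Yosida

/-! ### Global solutions of Lipschitz evolution equations. -/

section ODE

variable {H : Type*} [NormedAddCommGroup H] [NormedSpace ℝ H] [CompleteSpace H]

/-- Global solvability of `y' = u - A(y)`, `y(0) = y₀` for continuous `u` and Lipschitz `A`. -/
theorem exists_hasDerivAt_eq_sub_lipschitz {T : ℝ} (hT : 0 ≤ T) {u : ℝ → H} (hu : Continuous u)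
    {A : H → H} {K : NNReal} (hA : LipschitzWith K A) (y₀ : H) :
    ∃ y : ℝ → H, Continuous y ∧ y 0 = y₀ ∧
      ∀ t ∈ Icc 0 T, HasDerivAt y (u t - A (y t)) t := by
  -- The fixed point is sought for `w(t) = exp(-M t) y(t)`: in this weighted norm the Picard map
  -- contracts by `K / (K + 1)` on all of `[0,T]` at once. Extending `w` by `projIcc` gives
  -- two-sided derivatives at the endpoints too.
  set M : ℝ := K + 1 with hM
  have hMpos : 0 < M := by positivity
  let f : C(Icc 0 T, H) → ℝ → H := fun w s =>
    u s - A (Real.exp (M * s) • w (projIcc 0 T hT s))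
  have hf : ∀ w, Continuous (f w) := fun w => by
    have h1 : Continuous fun s => w (projIcc 0 T hT s) := w.continuous.comp continuous_projIcc
    exact hu.sub (hA.continuous.comp (by fun_prop))
  let y : C(Icc 0 T, H) → ℝ → H := fun w t => y₀ + ∫ s in (0 : ℝ)..t, f w s
  have hy : ∀ w t, HasDerivAt (y w) (f w t) t := fun w t =>
    (hasDerivAt_integral (hf w) t).const_add y₀
  have hyc : ∀ w, Continuous (y w) := fun w =>
    continuous_iff_continuousAt.2 fun t => (hy w t).continuousAt
  let Φ : C(Icc 0 T, H) → C(Icc 0 T, H) := fun w =>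
    ⟨fun t => Real.exp (-(M * t)) • y w t, by
      have := hyc w
      fun_prop⟩
  have hΦ : LipschitzWith (K / (K + 1)) Φ := by
    refine LipschitzWith.of_dist_le_mul fun w w' => ?_
    rw [ContinuousMap.dist_le (by positivity)]
    intro t
    have ht0 : 0 ≤ (t : ℝ) := t.2.1
    have h1 : ∀ s, ‖f w s - f w' s‖ ≤ K * dist w w' * Real.exp (M * s) := fun s => by
      have h2 := hA.dist_le_mul (Real.exp (M * s) • w' (projIcc 0 T hT s))
        (Real.exp (M * s) • w (projIcc 0 T hT s))
      rw [dist_eq_norm, dist_smul₀, Real.norm_of_nonneg (Real.exp_pos _).le] at h2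
      simp only [f, sub_sub_sub_cancel_left]
      refine h2.trans ?_
      have h3 : dist (w' (projIcc 0 T hT s)) (w (projIcc 0 T hT s)) ≤ dist w w' := by
        rw [dist_comm]; exact ContinuousMap.dist_apply_le_dist _
      calc (K : ℝ) * (Real.exp (M * s) * _) ≤ K * (Real.exp (M * s) * dist w w') := by gcongr
        _ = _ := by ring
    have h4 : ∫ s in (0 : ℝ)..t, K * dist w w' * Real.exp (M * s)
        = K * dist w w' / M * (Real.exp (M * t) - 1) := by
      rw [intervalIntegral.integral_eq_sub_of_hasDerivAt
        (f := fun s => K * dist w w' / M * Real.exp (M * s))]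
      · simp; ring
      · intro s _
        refine ((((hasDerivAt_id' s).const_mul M).exp).const_mul (K * dist w w' / M)).congr_deriv ?_
        field_simp
      · exact Continuous.intervalIntegrable (by fun_prop) _ _
    have h5 : ‖y w t - y w' t‖ ≤ K * dist w w' / M * (Real.exp (M * t) - 1) := by
      simp only [y, add_sub_add_left_eq_sub]
      rw [← intervalIntegral.integral_sub ((hf w).intervalIntegrable _ _)
        ((hf w').intervalIntegrable _ _), ← h4]
      exact intervalIntegral.norm_integral_le_of_norm_le ht0 (Eventually.of_forall fun s _ => h1 s)
        (Continuous.intervalIntegrable (by fun_prop) _ _)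
    have h6 : dist (Φ w t) (Φ w' t) = Real.exp (-(M * t)) * ‖y w t - y w' t‖ := by
      simp only [Φ, ContinuousMap.coe_mk]
      rw [dist_smul₀, Real.norm_of_nonneg (Real.exp_pos _).le, dist_eq_norm]
    rw [h6]
    have h7 : Real.exp (-(M * t)) * Real.exp (M * t) = 1 := by rw [← Real.exp_add]; simp
    calc Real.exp (-(M * t)) * ‖y w t - y w' t‖
        ≤ Real.exp (-(M * t)) * (K * dist w w' / M * (Real.exp (M * t) - 1)) := by gcongr
      _ = K * dist w w' / M * (Real.exp (-(M * t)) * Real.exp (M * t) - Real.exp (-(M * t))) := by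
          ring
      _ ≤ K * dist w w' / M * 1 := by
          rw [h7]
          gcongr
          linarith [Real.exp_pos (-(M * t))]
      _ = ((K / (K + 1) : NNReal) : ℝ) * dist w w' := by
          rw [NNReal.coe_div, NNReal.coe_add, NNReal.coe_one, ← hM]; ring
  have hcontr : ContractingWith (K / (K + 1)) Φ :=
    ⟨by rw [div_lt_one (by positivity)]; exact lt_add_one K, hΦ⟩
  obtain ⟨w, hw⟩ : ∃ w, Φ w = w := ⟨_, hcontr.fixedPoint_isFixedPt⟩
  refine ⟨y w, hyc w, by simp [y], fun t ht => ?_⟩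
  have h8 : Real.exp (M * t) • w (projIcc 0 T hT t) = y w t := by
    conv_lhs => rw [← hw]
    simp only [Φ, ContinuousMap.coe_mk, projIcc_of_mem hT ht, smul_smul]
    rw [← Real.exp_add]; simp
  have h9 := hy w t
  simp only [f] at h9
  rwa [h8] at h9

end ODE

/-! ### Existence of gradient flows as zeros of the functional. -/

section GradientFlow

variable {T : ℝ} {H : Type*} [NormedAddCommGroup H] [InnerProductSpace ℝ H]

/-- The a priori estimate extracted from the energy inequality. -/
theorem norm_timeDeriv_le {y : H1 T H} {u : L2 T H} {y₀ a : H} {b c r D : ℝ}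
    (hy : evalAt 0 y = y₀) (hr : r ≤ 1) (hD : ‖u‖ ≤ D)
    (h : ‖timeDeriv y‖ ^ 2 ≤ inner ℝ u (timeDeriv y) + c
      - (inner ℝ a (evalAt T y) + b - r / 2 * ‖a‖ ^ 2)) :
    ‖timeDeriv y‖ ≤ (D + ‖a‖ * √(max T 0)) + |c + ‖a‖ * ‖y₀‖ - b + 1 / 2 * ‖a‖ ^ 2| + 1 := by
  have h1 : inner ℝ u (timeDeriv y) ≤ D * ‖timeDeriv y‖ :=
    (real_inner_le_norm _ _).trans (by gcongr)
  have h2 : -inner ℝ a (evalAt T y) ≤ ‖a‖ * (‖y₀‖ + √(max T 0) * ‖timeDeriv y‖) := by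
    rw [← inner_neg_left]
    refine (real_inner_le_norm _ _).trans ?_
    rw [norm_neg, evalAt_eq_add, hy]
    gcongr
    exact (norm_add_le _ _).trans (by gcongr; exact norm_evalPrim_le T _)
  have h3 : r / 2 * ‖a‖ ^ 2 ≤ 1 / 2 * ‖a‖ ^ 2 := by gcongr
  have h4 := le_abs_self (c + ‖a‖ * ‖y₀‖ - b + 1 / 2 * ‖a‖ ^ 2)
  have h5 := abs_nonneg (c + ‖a‖ * ‖y₀‖ - b + 1 / 2 * ‖a‖ ^ 2)
  set B := |c + ‖a‖ * ‖y₀‖ - b + 1 / 2 * ‖a‖ ^ 2|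
  set A := D + ‖a‖ * √(max T 0) with hA
  have hA0 : 0 ≤ A := add_nonneg ((norm_nonneg u).trans hD) (by positivity)
  -- With `A, B ≥ 0`, the inequality `s² ≤ A s + B` excludes `s > A + B + 1`.
  have h6 : ‖timeDeriv y‖ ^ 2 ≤ A * ‖timeDeriv y‖ + B := by
    rw [hA]; linarith
  by_contra hlt
  nlinarith [norm_nonneg (timeDeriv y)]

variable [CompleteSpace H] {φ : H → EReal}

/-- A trajectory of the gradient flow regularized by the Yosida approximation of parameter `r`,
for a continuous right-hand side: here `v = y'` and `z = y - r(u - y')` is the resolvent of `y`. -/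
theorem exists_yosida_flow (hT : 0 < T) (hφ : IsConvexProperLsc φ) {a : H} {b : ℝ}
    (hab : ∀ x, ((inner ℝ a x + b : ℝ) : EReal) ≤ φ x) {y₀ : H} (hy₀ : φ y₀ < ⊤)
    {r : ℝ} (hr : 0 < r) (f : BoundedContinuousFunction ℝ H) {u : L2 T H}
    (hu : u =ᵐ[timeMeasure T] f) :
    ∃ y : H1 T H, evalAt 0 y = y₀ ∧
      ‖timeDeriv y‖ ^ 2 ≤ inner ℝ u (timeDeriv y) + (φ y₀).toReal
        - (inner ℝ a (evalAt T y) + b - r / 2 * ‖a‖ ^ 2) ∧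
      ∃ ρ : ℝ, 0 ≤ ρ ∧
        ρ = inner ℝ (u - timeDeriv y) (toL2 y - r • (u - timeDeriv y))
            - (inner ℝ a (evalPrim T (toL2 y - r • (u - timeDeriv y))) + T * b)
            - (inner ℝ y₀ (evalPrim T (u - timeDeriv y)) + T * -(φ y₀).toReal) ∧
        excessIntegral φ a b (toL2 y - r • (u - timeDeriv y))
          + excessIntegral (conjugate φ) y₀ (-(φ y₀).toReal) (u - timeDeriv y)
          = ENNReal.ofReal ρ := by
  have hA := lipschitzWith_yosida hφ hr
  obtain ⟨y, hyc, hy0, hy⟩ := exists_hasDerivAt_eq_sub_lipschitz hT.le f.continuous hA y₀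
  set g : ℝ → H := fun t => f t - yosida hφ hr (y t) with hg
  have hgc : Continuous g := f.continuous.sub (hA.continuous.comp hyc)
  obtain ⟨C, hC⟩ := isCompact_Icc.exists_bound_of_continuousOn (s := Icc 0 T) hgc.continuousOn
  have hgL : MemLp g 2 (timeMeasure T) := MemLp.of_bound hgc.aestronglyMeasurable C
    (ae_mem_Ioo.mono fun t ht => hC t (Ioo_subset_Icc_self ht))
  set v : L2 T H := hgL.toLp with hv
  have hvg : v =ᵐ[timeMeasure T] g := hgL.coeFn_toLp
  set Y := ofDeriv hT.le y₀ v with hY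
  have hYv : timeDeriv Y = v := timeDeriv_ofDeriv hT.le y₀ v
  have hYt : ∀ t ∈ Icc 0 T, evalAt t Y = y t := fun t ht => by
    rw [evalAt_eq_add, hYv, evalPrim_of_ae_eq hvg ht,
      intervalIntegral.integral_eq_sub_of_hasDerivAt (f := y), hY, evalAt_zero_ofDeriv hT, hy0,
      add_sub_cancel]
    · intro s hs
      rw [uIcc_of_le ht.1] at hs
      exact hy s ⟨hs.1, hs.2.trans ht.2⟩
    · exact hgc.intervalIntegrable _ _
  have hYae : toL2 Y =ᵐ[timeMeasure T] y := by
    filter_upwards [ae_eq_evalAt hT Y, ae_mem_Ioo] with t h1 h2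
    rw [toL2_apply, h1, hYt t (Ioo_subset_Icc_self h2)]
  have hw : (u - v : L2 T H) =ᵐ[timeMeasure T] fun t => yosida hφ hr (y t) := by
    filter_upwards [Lp.coeFn_sub u v, hu, hvg] with t h1 h2 h3
    rw [h1, Pi.sub_apply, h2, h3, hg, sub_sub_cancel]
  have hz : (toL2 Y - r • (u - v) : L2 T H) =ᵐ[timeMeasure T]
      fun t => resolvent hφ hr (y t) := by
    filter_upwards [Lp.coeFn_sub (toL2 Y) (r • (u - v)), Lp.coeFn_smul r (u - v), hw, hYae]
      with t h1 h2 h3 h4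
    rw [h1, Pi.sub_apply, h2, Pi.smul_apply, h3, h4, resolvent_eq]
  refine ⟨Y, by rw [hYt 0 (left_mem_Icc.2 hT.le), hy0], ?_, ?_⟩
  · rw [hYv, hYt T (right_mem_Icc.2 hT.le)]
    -- The envelope along `y` has derivative `(yosida y, y')`, that is `(u - y', y')`; integrating
    -- it gives the energy identity.
    have h1 : ∀ t ∈ Icc 0 T, HasDerivAt (fun t => moreau hφ hr (y t))
        (inner ℝ (yosida hφ hr (y t)) (g t)) t := fun t ht =>
      (hasFDerivAt_moreau hφ hr (y t)).comp_hasDerivAt t (hy t ht)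
    have h2 := intervalIntegral.integral_eq_sub_of_hasDerivAt (a := 0) (b := T)
      (fun t ht => h1 t (by rwa [uIcc_of_le hT.le] at ht))
      (Continuous.intervalIntegrable ((hA.continuous.comp hyc).inner hgc) _ _)
    have h3 : inner ℝ (u - v) v = moreau hφ hr (y T) - moreau hφ hr (y 0) := by
      rw [← h2, ← integral_timeMeasure hT.le, L2.inner_def]
      refine integral_congr_ae ?_
      filter_upwards [hw, hvg] with t h4 h5
      rw [h4, h5]
    have h4 := moreau_le hφ hr y₀ hy₀.ne
    have h5 := le_moreau hφ hr hab (y T)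
    rw [inner_sub_left, real_inner_self_eq_norm_sq, hy0] at h3
    linarith
  · rw [hYv]
    set w := u - v
    set z := toL2 Y - r • w
    -- Since `w(t) ∈ ∂φ(z(t))` at the resolvent `z(t)`, Fenchel equality makes the sum of the two
    -- excesses equal to `h` pointwise; it would not hold at `y(t)` itself.
    let h : ℝ → ℝ := fun t => inner ℝ (w t) (z t) - (inner ℝ a (z t) + b)
      - (inner ℝ y₀ (w t) + -(φ y₀).toReal)
    have hi1 : Integrable (fun t => inner ℝ (w t) (z t) - (inner ℝ a (z t) + b)) (timeMeasure T) :=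
      (integrable_inner_L2 w z).sub (integrable_affine a b z)
    have hi : Integrable h (timeMeasure T) := hi1.sub (integrable_affine y₀ _ w)
    have hint : ∫ t, h t ∂(timeMeasure T) = inner ℝ w z - (inner ℝ a (evalPrim T z) + T * b)
        - (inner ℝ y₀ (evalPrim T w) + T * -(φ y₀).toReal) := by
      rw [integral_sub hi1 (integrable_affine y₀ _ w), integral_sub (integrable_inner_L2 w z)
        (integrable_affine a b z), integral_affine hT.le, integral_affine hT.le, L2.inner_def]
    have hpt : ∀ᵐ t ∂(timeMeasure T), 0 ≤ h t ∧
        excess φ a b (z t) + excess (conjugate φ) y₀ (-(φ y₀).toReal) (w t)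
          = ENNReal.ofReal (h t) := by
      filter_upwards [hw, hz] with t h1 h2
      have e1 := (hφ.coe_toReal ((mem_subdifferential_iff hφ).1
        (yosida_mem_subdifferential hφ hr (y t))).1).symm
      have e2 := fenchel_eq_yosida hφ hr (y t)
      have e3 := hab (resolvent hφ hr (y t))
      have e4 := conjugate_affine_le hφ hy₀ (yosida hφ hr (y t))
      rw [e1, EReal.coe_le_coe_iff] at e3
      rw [e2, EReal.coe_le_coe_iff] at e4
      simp only [h]
      rw [h1, h2, excess_of_eq_coe e1, excess_of_eq_coe e2,
        ← ENNReal.ofReal_add (by linarith) (by linarith)]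
      exact ⟨by linarith, by congr 1; ring⟩
    have hnn : 0 ≤ᵐ[timeMeasure T] h := hpt.mono fun t ht => ht.1
    refine ⟨∫ t, h t ∂(timeMeasure T), integral_nonneg_of_ae hnn, hint, ?_⟩
    rw [ofReal_integral_eq_lintegral_ofReal hi hnn, excessIntegral, excessIntegral,
      ← lintegral_add_left' (aemeasurable_excess hφ a b z)]
    exact lintegral_congr_ae (hpt.mono fun t ht => ht.2)

theorem norm_H1_le_of_evalAt (hT : 0 < T) {y : H1 T H} {y₀ : H} (hy : evalAt 0 y = y₀) {C : ℝ}
    (hC : ‖timeDeriv y‖ ≤ C) :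
    ‖y‖ ≤ ‖Lp.const 2 (timeMeasure T) y₀‖ + ‖prim (T := T) (H := H)‖ * C + C := by
  refine (norm_H1_le y).trans (add_le_add ?_ hC)
  rw [toL2_eq hT, hy]
  exact (norm_add_le _ _).trans (by gcongr; exact prim.le_opNorm_of_le hC)

/-- Every `u ∈ L²(0,T;H)` admits a trajectory at which the functional vanishes. -/
theorem exists_benFunctional_eq_zero [TopologicalSpace.SeparableSpace H] (hT : 0 < T)
    (hφ : IsConvexProperLsc φ) {y₀ : H} (hy₀ : φ y₀ < ⊤) (u : L2 T H) :
    ∃ p : ControlState T H, p.control = u ∧ benFunctional φ y₀ p = 0 := by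
  classical
  obtain ⟨a, b, hab⟩ := hφ.exists_affine_le
  have happrox : ∀ n : ℕ, ∃ f : BoundedContinuousFunction ℝ H,
      dist u (BoundedContinuousFunction.toLp 2 (timeMeasure T) ℝ f) < 1 / ((n : ℝ) + 1) := fun n =>
    (BoundedContinuousFunction.toLp_denseRange (E := H) (μ := timeMeasure T) ℝ
      (by norm_num : (2 : ℝ≥0∞) ≠ ⊤)).exists_dist_lt u Nat.one_div_pos_of_nat
  choose f hf using happrox
  set un : ℕ → L2 T H := fun n => BoundedContinuousFunction.toLp 2 (timeMeasure T) ℝ (f n) with hun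
  -- The number `1 / (n + 1)` serves both as the accuracy of the approximation of `u` and as the
  -- Yosida parameter.
  have hrpos : ∀ n : ℕ, 0 < 1 / ((n : ℝ) + 1) := fun n => Nat.one_div_pos_of_nat
  have hrle : ∀ n : ℕ, 1 / ((n : ℝ) + 1) ≤ 1 := fun n => by
    rw [div_le_one (by positivity)]; linarith [(Nat.cast_nonneg n : (0 : ℝ) ≤ n)]
  have hr0 := tendsto_one_div_add_atTop_nhds_zero_nat (𝕜 := ℝ)
  have hunu : Tendsto un atTop (𝓝 u) :=
    tendsto_iff_dist_tendsto_zero.2 (squeeze_zero (fun _ => dist_nonneg)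
      (fun n => by rw [dist_comm]; exact (hf n).le) hr0)
  have hflow := fun n => exists_yosida_flow hT hφ hab hy₀ (hrpos n) (f n)
    (BoundedContinuousFunction.coeFn_toLp (p := 2) (timeMeasure T) (𝕜 := ℝ) (f n))
  choose Y hY0 hYen ρ hρ0 hρ hYex using hflow
  have hunb : ∀ n, ‖un n‖ ≤ ‖u‖ + 1 := fun n => by
    have h1 : ‖un n - u‖ ≤ 1 := by
      rw [← dist_eq_norm, dist_comm]; exact (hf n).le.trans (hrle n)
    calc ‖un n‖ = ‖u + (un n - u)‖ := by rw [add_sub_cancel]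
      _ ≤ _ := (norm_add_le _ _).trans (by gcongr)
  obtain ⟨C, hC⟩ : ∃ C, ∀ n, ‖timeDeriv (Y n)‖ ≤ C :=
    ⟨_, fun n => norm_timeDeriv_le (hY0 n) (hrle n) (hunb n) (hYen n)⟩
  obtain ⟨R, hR⟩ : ∃ R, ∀ n, ‖Y n‖ ≤ R := ⟨_, fun n => norm_H1_le_of_evalAt hT (hY0 n) (hC n)⟩
  obtain ⟨y, k, hk, hky⟩ := exists_subseq_tendsto_weak hR
  let pn : ℕ → ControlState T H := fun n => (un (k n), toWeakSpace ℝ (H1 T H) (Y (k n)))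
  let p : ControlState T H := (u, toWeakSpace ℝ (H1 T H) y)
  have hpn : Tendsto pn atTop (𝓝 p) := (hunu.comp hk.tendsto_atTop).prodMk_nhds hky
  refine ⟨p, rfl, ?_⟩
  -- the regularizing term vanishes in the limit
  let δ : ℕ → L2 T H := fun n =>
    (1 / ((k n : ℝ) + 1)) • (un (k n) - timeDeriv (Y (k n)))
  have hδ : Tendsto δ atTop (𝓝 0) := by
    refine squeeze_zero_norm (a := fun n => 1 / ((k n : ℝ) + 1) * (‖u‖ + 1 + C)) (fun n => ?_) ?_
    · simp only [δ]
      rw [norm_smul, Real.norm_of_nonneg (hrpos _).le]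
      gcongr
      exact (norm_sub_le _ _).trans (add_le_add (hunb _) (hC _))
    · simpa using (hr0.comp hk.tendsto_atTop).mul_const (‖u‖ + 1 + C)
  -- The first slot holds the resolvent rather than the state, the Fenchel equality being available
  -- only there; the difference `δ` vanishes, so the limit is unaffected.
  let qn : ℕ → WeakSpace ℝ (L2 T H) × WeakSpace ℝ (L2 T H) × WeakSpace ℝ H := fun n =>
    (toWeakSpace ℝ (L2 T H) (toL2 (Y (k n)) - δ n), (weakVariables (pn n)).2)
  have hqn : Tendsto qn atTop (𝓝 (weakVariables p)) := by
    have h1 := (continuous_weakVariables.tendsto p).comp hpn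
    have h2 : Tendsto (fun n => toWeakSpace ℝ (L2 T H) (δ n)) atTop
        (𝓝 (toWeakSpace ℝ (L2 T H) 0)) :=
      ((toWeakSpaceCLM ℝ (L2 T H)).continuous.tendsto 0).comp hδ
    have h3 := ((continuous_fst.tendsto _).comp h1).sub h2
    rw [map_zero, sub_zero] at h3
    exact h3.prodMk_nhds ((continuous_snd.tendsto _).comp h1)
  have hlo : Tendsto (fun n => lowerOrder φ a b y₀ (pn n)) atTop (𝓝 (lowerOrder φ a b y₀ p)) := by
    -- `lowerOrder` is continuous on sets with bounded states, so the sequence and its limit are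
    -- collected in one such set.
    have hK : ∀ q ∈ insert p (range pn), ‖ControlState.state q‖ ≤ max R ‖y‖ := by
      rintro q (rfl | ⟨n, rfl⟩)
      · exact le_max_right _ _
      · exact (hR (k n)).trans (le_max_left _ _)
    exact ((continuousOn_lowerOrder φ a b y₀ hK) p (mem_insert _ _)).tendsto.comp
      (tendsto_nhdsWithin_iff.2 ⟨hpn, Eventually.of_forall fun n =>
        mem_insert_of_mem _ (mem_range_self n)⟩)
  have hbound : Tendsto (fun n => -lowerOrder φ a b y₀ (pn n) + inner ℝ a (evalPrim T (δ n))) atTop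
      (𝓝 (-lowerOrder φ a b y₀ p)) := by
    have h1 : Tendsto (fun n => inner ℝ a (evalPrim T (δ n))) atTop (𝓝 (0 : ℝ)) := by
      have := ((((innerSL ℝ a).comp (evalPrim T)).continuous.tendsto (0 : L2 T H))).comp hδ
      rwa [map_zero] at this
    simpa using hlo.neg.add h1
  -- The regularized flows satisfy the desired inequality `G ≤ 0` up to an error from `δ`: the chain
  -- rule yields the boundary terms, and the nonnegative `(u - y', δ)` is dropped.
  have hE : ∀ n, ρ (k n) + 1 / 2 * ‖evalAt T (Y (k n))‖ ^ 2
      ≤ -lowerOrder φ a b y₀ (pn n) + inner ℝ a (evalPrim T (δ n)) := fun n => by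
    have h1 := inner_timeDeriv_self hT (Y (k n))
    rw [hY0] at h1
    have h2 : 0 ≤ inner ℝ (un (k n) - timeDeriv (Y (k n))) (δ n) := by
      simp only [δ]
      rw [real_inner_smul_right, real_inner_self_eq_norm_sq]
      exact mul_nonneg (hrpos _).le (sq_nonneg _)
    rw [hρ (k n)]
    change inner ℝ (un (k n) - timeDeriv (Y (k n))) (toL2 (Y (k n)) - δ n)
      - (inner ℝ a (evalPrim T (toL2 (Y (k n)) - δ n)) + T * b)
      - (inner ℝ y₀ (evalPrim T (un (k n) - timeDeriv (Y (k n)))) + T * -(φ y₀).toReal)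
      + 1 / 2 * ‖evalAt T (Y (k n))‖ ^ 2 ≤
      -((inner ℝ a (evalPrim T (toL2 (Y (k n)))) + T * b)
        + (inner ℝ y₀ (evalPrim T (un (k n) - timeDeriv (Y (k n)))) + T * -(φ y₀).toReal)
        - inner ℝ (un (k n)) (toL2 (Y (k n))) - 1 / 2 * ‖y₀‖ ^ 2) + inner ℝ a (evalPrim T (δ n))
    rw [inner_sub_right (un (k n) - timeDeriv (Y (k n))), inner_sub_left (un (k n)),
      map_sub (evalPrim T) (toL2 (Y (k n))), inner_sub_right a, h1]
    linarith
  have hnn : 0 ≤ -lowerOrder φ a b y₀ p :=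
    ge_of_tendsto' hbound fun n => (add_nonneg (hρ0 _) (by positivity)).trans (hE n)
  -- Semicontinuity carries the inequality to the limit, where it reads `G ≤ 0`.
  have hWle : weakEnergy φ a b y₀ (weakVariables p) ≤ ENNReal.ofReal (-lowerOrder φ a b y₀ p) := by
    have h1 := lowerSemicontinuous_iff_le_liminf.1
      (lowerSemicontinuous_weakEnergy (T := T) hφ hab hy₀) (weakVariables p)
    have h2 : liminf (weakEnergy φ a b y₀) (𝓝 (weakVariables p))
        ≤ liminf (fun n => weakEnergy φ a b y₀ (qn n)) atTop :=
      (liminf_le_liminf_of_le hqn).trans le_rfl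
    refine (h1.trans h2).trans ?_
    rw [← (ENNReal.tendsto_ofReal hbound).liminf_eq]
    refine liminf_le_liminf (Eventually.of_forall fun n => ?_)
    have h3 : weakEnergy φ a b y₀ (qn n)
        = ENNReal.ofReal (ρ (k n)) + ENNReal.ofReal (1 / 2 * ‖evalAt T (Y (k n))‖ ^ 2) := by
      rw [← hYex (k n)]; rfl
    rw [h3, ← ENNReal.ofReal_add (hρ0 _) (by positivity)]
    exact ENNReal.ofReal_le_ofReal (hE n)
  have h0 : evalAt 0 p.state = y₀ := by
    have h1 : Tendsto (fun n => toWeakSpace ℝ H (evalAt 0 (Y (k n)))) atTop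
        (𝓝 (toWeakSpace ℝ H (evalAt 0 y))) :=
      ((WeakSpace.map (evalAt (T := T) (H := H) 0)).continuous.tendsto _).comp hky
    simp only [hY0] at h1
    exact (toWeakSpace ℝ H).injective (tendsto_nhds_unique h1 tendsto_const_nhds)
  refine le_antisymm ?_ (benFunctional_nonneg hT hφ y₀ p)
  rw [benFunctional_eq hT hφ hab hy₀, if_pos h0]
  calc (weakEnergy φ a b y₀ (weakVariables p) : EReal) + (lowerOrder φ a b y₀ p : ℝ)
      ≤ ((ENNReal.ofReal (-lowerOrder φ a b y₀ p) : ℝ≥0∞) : EReal)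
        + (lowerOrder φ a b y₀ p : ℝ) :=
        add_le_add (EReal.coe_ennreal_le_coe_ennreal_iff.2 hWle) le_rfl
    _ = 0 := by
      rw [EReal.coe_ennreal_ofReal, max_eq_left hnn, ← EReal.coe_add, neg_add_cancel,
        EReal.coe_zero]

end GradientFlow

end BEN

end

/-! ### Assembly of the theorem. -/

theorem theorem3p1 {H : Type*} [NormedAddCommGroup H] [InnerProductSpace ℝ H] [CompleteSpace H]
    [TopologicalSpace.SeparableSpace H] (T : ℝ) (hT : 0 < T)
    (φ : H → EReal) (hφ : BEN.IsConvexProperLsc φ) (y₀ : H) (hy₀ : φ y₀ < ⊤)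
    (U : Set (BEN.L2 T H)) (hUne : U.Nonempty) (hU : IsCompact U)
    (F : BEN.ControlState T H → ℝ≥0∞) (hFlsc : LowerSemicontinuous F)
    (hFcoer : BEN.IsCoercive F) (hFU : ∀ p, F p < ⊤ → p.control ∈ U)
    (G : BEN.ControlState T H → EReal) (hG : G = BEN.benFunctional φ y₀)
    (E : ℝ → BEN.ControlState T H → EReal) (hE : E = BEN.penalized F G)
    (E₀ : BEN.ControlState T H → EReal) (hE₀ : E₀ = BEN.constrained F G) :
    -- `min E_ε` has a solution
    (∀ ε : ℝ, 0 < ε → ∃ p, BEN.IsMinimizer (E ε) p) ∧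
    -- Γ-convergence
    BEN.GammaConverges E E₀ ∧
    -- provided that the target is finite on the solutions of the gradient flow for at least one
    -- admissible control, the functionals are proper and quasiminimizers subconverge
    ((∃ u ∈ U, ∀ p : BEN.ControlState T H, p.control = u →
        BEN.IsGradientFlow φ y₀ u p.state → F p < ⊤) →
      (∀ ε : ℝ, 0 < ε → ∃ p, E ε p < ⊤) ∧
      ∀ (ε : ℕ → ℝ) (p : ℕ → BEN.ControlState T H), (∀ n, 0 < ε n) → Tendsto ε atTop (𝓝 0) →
        liminf (fun n => E (ε n) (p n) - ⨅ q, E (ε n) q) atTop = 0 →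
        ∃ (k : ℕ → ℕ) (p₀ : BEN.ControlState T H), StrictMono k ∧
          Tendsto (fun n => p (k n)) atTop (𝓝 p₀) ∧ BEN.IsMinimizer E₀ p₀) ∧
    -- if `min E_0` has a unique solution, whole sequences of quasiminimizers converge to it
    (∀ p₀ : BEN.ControlState T H, (∀ q, BEN.IsMinimizer E₀ q ↔ q = p₀) →
      ∀ (ε : ℕ → ℝ) (p : ℕ → BEN.ControlState T H), (∀ n, 0 < ε n) → Tendsto ε atTop (𝓝 0) →
        Tendsto (fun n => E (ε n) (p n) - ⨅ q, E (ε n) q) atTop (𝓝 0) →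
        Tendsto p atTop (𝓝 p₀)) := by
  -- Nonnegativity of `G` allows the abstract results for `ℝ≥0∞`-valued penalties to be used.
  obtain ⟨g, hg⟩ : ∃ g : BEN.ControlState T H → ℝ≥0∞, G = fun p => (g p : EReal) :=
    ⟨fun p => (G p).toENNReal, funext fun p => (EReal.coe_toENNReal (by
      rw [hG]; exact BEN.benFunctional_nonneg hT hφ y₀ p)).symm⟩
  have hglsc : ∀ K, IsCompact K → LowerSemicontinuousOn g K := fun K hK => by
    have h1 := EReal.continuous_toENNReal.comp_lowerSemicontinuousOn
      (BEN.lowerSemicontinuousOn_benFunctional hT hφ hy₀ hK)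
      fun x y h => EReal.toENNReal_le_toENNReal h
    rw [← hG, hg] at h1
    simpa [Function.comp_def] using h1
  subst hE hE₀
  rw [hg]
  refine ⟨fun ε hε => BEN.exists_isMinimizer_penalized hFlsc hFcoer hglsc hε,
    BEN.gammaConverges_penalized hFlsc hFcoer hglsc, ?_, ?_⟩
  · rintro ⟨u, -, hu⟩
    obtain ⟨q, hqu, hq⟩ := BEN.exists_benFunctional_eq_zero hT hφ hy₀ u
    -- The assumption covers every flow with control `u`, in particular the one just constructed, so
    -- uniqueness of the flow need not be proved.
    have hqF : F q < ⊤ := hu q hqu (hqu ▸ BEN.isGradientFlow_of_benFunctional_eq_zero hT hφ hq)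
    have hgq : (g q : EReal) = 0 := by rw [← hq, ← hG, hg]
    have hqE : BEN.constrained F (fun p => (g p : EReal)) q < ⊤ := by
      rw [BEN.constrained, if_pos hgq, ← EReal.coe_ennreal_top]
      exact EReal.coe_ennreal_lt_coe_ennreal_iff.2 hqF
    exact ⟨fun ε hε => ⟨q, (BEN.penalized_le_constrained F g hε q).trans_lt hqE⟩,
      fun ε p hε hε0 hlim => BEN.exists_subseq_tendsto_minimizer hFlsc hFcoer hglsc
        (fun K hK => BEN.isSeqCompact_of_isCompact_controlState hK) hqE hε hε0 hlim⟩
  · exact fun p₀ hp₀ ε p hε hε0 hlim =>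
      BEN.tendsto_of_unique_minimizer hFlsc hFcoer hglsc hp₀ hε hε0 hlim
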